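/- Let $\alpha\ge\beta\ge-1/2$, $\alpha>-1/2$, $\tau>0$, $\rho=\alpha+\beta+1$ and $\Delta(t)=2^{2\rho}(\sinh t)^{2\alpha+1}(\cosh t)^{2\beta+1}$. For real $\lambda$ let the Jacobi function $\varphi_\lambda$ be the even function on $\mathbb{R}$ that solves $(\Delta\varphi_\lambda')'+(\lambda^2+\rho^2)\Delta\varphi_\lambda=0$ for $t>0$, with $\varphi_\lambda(0)=1$, $\varphi_\lambda'(0)=0$, and put $\psi_\lambda=\varphi_\lambda/\varphi_0$. Let $0<\lambda_1(\tau)<\lambda_2(\tau)<\cdots$ be the positive zeros of $\lambda\mapsto\varphi_\lambda(\tau)$, and let $0<\lambda_1^*(\tau)<\lambda_2^*(\tau)<\cdots$ be the positive zeros of $\lambda\mapsto\psi_\lambda'(\tau)$, where $'$ denotes the derivative in $t$. For an interval $I$ let $N_I(p)$ be the number of zeros of $p$ on $I$, where zeros in the interior of $I$ are counted with multiplicity and a zero at an endpoint belonging to $I$ is counted once. A sequence $f_1,f_2,\dots$ of real functions is a Chebyshev system on $I$ if $N_I(p)\le n-1$ for every $n\ge1$ and every $p=\sum_{k=1}^nA_kf_k$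 with real coefficients $A_1,\dots,A_n$ that are not all zero. (i) $\{\psi_{\lambda_k(\tau)}\}_{k=1}^\infty$ is a Chebyshev system on $(0,\tau)$, and $\{1\}\cup\{\psi_{\lambda_k^*(\tau)}\}_{k=1}^\infty$ (in this order, the constant function first) is a Chebyshev system on $[0,\tau]$. (ii) $\{\psi_{\lambda_k^*(\tau)}'\}_{k=1}^\infty$ and $\{\psi_{\lambda_k^*(\tau)}-\psi_{\lambda_k^*(\tau)}(\tau)\}_{k=1}^\infty$ are Chebyshev systems on $(0,\tau)$. -/

import Mathlib

/-- The parameter `ρ = α + β + 1`. -/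
noncomputable def jacobiRho (α β : ℝ) : ℝ := α + β + 1

/-- The weight `Δ(t) = 2^{2ρ} (sinh t)^{2α+1} (cosh t)^{2β+1}`. -/
noncomputable def jacobiWeight (α β t : ℝ) : ℝ :=
  (2 : ℝ) ^ (2 * jacobiRho α β) * Real.sinh t ^ (2 * α + 1) * Real.cosh t ^ (2 * β + 1)

/-- `φ` is the even function on `ℝ` that solves, on `t > 0`, the Sturm–Liouville problem
`(Δ φ')' + (lam² + ρ²) Δ φ = 0`, `φ(0) = 1`, `φ'(0) = 0`. -/
structure IsJacobiFunction (α β lam : ℝ) (φ : ℝ → ℝ) : Prop where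
  even : ∀ t, φ (-t) = φ t
  map_zero : φ 0 = 1
  deriv_zero : HasDerivAt φ 0 0
  differentiable : ∀ t, 0 < t → DifferentiableAt ℝ φ t
  ode : ∀ t, 0 < t → HasDerivAt (fun s => jacobiWeight α β s * deriv φ s)
    (-((lam ^ 2 + jacobiRho α β ^ 2) * jacobiWeight α β t * φ t)) t

/-- The Jacobi function `φ_lam^{(α,β)}`: the solution of the Sturm–Liouville problem.
It exists and is unique for `α ≥ β ≥ -1/2`, `α > -1/2`, see `jacobiPhi_spec` and
`IsJacobiFunction.eq_jacobiPhi`. -/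
noncomputable def jacobiPhi (α β lam : ℝ) : ℝ → ℝ :=
  Classical.epsilon (IsJacobiFunction α β lam)

namespace JacobiAux

open Filter Topology Set

/-- One step of the successive approximations: `w(s)⁻¹ ∫₀ˢ w f`. -/
noncomputable def inner (w f : ℝ → ℝ) (s : ℝ) : ℝ := (w s)⁻¹ * ∫ r in (0 : ℝ)..s, w r * f r

/-- Successive approximations for `(w φ')' = w φ`, `φ(0) = 1`, `φ'(0) = 0`. -/
noncomputable def approx (w : ℝ → ℝ) : ℕ → ℝ → ℝ
  | 0 => fun _ => 1
  | k + 1 => fun t => ∫ s in (0 : ℝ)..t, inner w (approx w k) s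

theorem inner_bound {w f : ℝ → ℝ} (hpos : ∀ t, t ≠ 0 → 0 < w t)
    (hmono : ∀ s t, |s| ≤ |t| → w s ≤ w t) (h0 : 0 ≤ w 0) (k : ℕ)
    (hb : ∀ t, |f t| ≤ (t ^ 2) ^ k / k.factorial) (t : ℝ) :
    |inner w f t| ≤ |t| * ((t ^ 2) ^ k / k.factorial) := by
  by_cases ht : t = 0
  · subst ht; simp [inner]
  have hw : 0 < w t := hpos t ht
  have hwn : ∀ s, 0 ≤ w s := fun s => by
    by_cases hs : s = 0
    · rw [hs]; exact h0
    · exact (hpos s hs).le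
  have key : ‖∫ r in (0 : ℝ)..t, w r * f r‖ ≤
      (w t * ((t ^ 2) ^ k / k.factorial)) * |t - 0| := by
    apply intervalIntegral.norm_integral_le_of_norm_le_const
    intro x hx
    have hxt : |x| ≤ |t| := by
      have := Set.abs_sub_left_of_mem_uIcc (Set.uIoc_subset_uIcc hx)
      simpa using this
    rw [Real.norm_eq_abs, abs_mul, abs_of_nonneg (hwn x)]
    have h2 : x ^ 2 ≤ t ^ 2 := sq_le_sq.2 hxt
    have h3 : |f x| ≤ (t ^ 2) ^ k / k.factorial := (hb x).trans (by gcongr)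
    exact mul_le_mul (hmono x t hxt) h3 (abs_nonneg _) hw.le
  rw [Real.norm_eq_abs, sub_zero] at key
  rw [inner, abs_mul, abs_inv, abs_of_pos hw]
  calc (w t)⁻¹ * |∫ r in (0 : ℝ)..t, w r * f r|
      ≤ (w t)⁻¹ * ((w t * ((t ^ 2) ^ k / k.factorial)) * |t|) := by gcongr
    _ = |t| * ((t ^ 2) ^ k / k.factorial) := by field_simp

theorem inner_continuous {w f : ℝ → ℝ} (hw : Continuous w) (hpos : ∀ t, t ≠ 0 → 0 < w t)
    (hmono : ∀ s t, |s| ≤ |t| → w s ≤ w t) (h0 : 0 ≤ w 0) (k : ℕ) (hf : Continuous f)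
    (hb : ∀ t, |f t| ≤ (t ^ 2) ^ k / k.factorial) : Continuous (inner w f) := by
  rw [continuous_iff_continuousAt]
  intro t
  by_cases ht : t = 0
  · subst ht
    have h1 : inner w f 0 = 0 := by simp [inner]
    rw [ContinuousAt, h1]
    have hlim : Tendsto (fun t : ℝ => |t| * ((t ^ 2) ^ k / k.factorial)) (𝓝 0) (𝓝 0) := by
      have : Continuous (fun t : ℝ => |t| * ((t ^ 2) ^ k / k.factorial)) := by fun_prop
      simpa using this.tendsto 0
    exact squeeze_zero_norm (fun t => by
      simpa using inner_bound hpos hmono h0 k hb t) hlim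
  · have hc : Continuous (fun t => ∫ r in (0 : ℝ)..t, w r * f r) :=
      intervalIntegral.continuous_primitive
        (fun a b => (hw.mul hf).intervalIntegrable a b) 0
    exact (hw.continuousAt.inv₀ (hpos t ht).ne').mul hc.continuousAt

theorem int_odd_pow (k : ℕ) (t : ℝ) : HasDerivAt
    (fun x : ℝ => (x ^ 2) ^ (k + 1) / (k + 1).factorial)
    (2 * (t * ((t ^ 2) ^ k / k.factorial))) t := by
  have h := (((hasDerivAt_id t).pow 2).pow (k + 1)).div_const ((k + 1).factorial : ℝ)
  refine h.congr_deriv ?_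
  rw [Nat.factorial_succ]
  push_cast
  simp only [id, Pi.pow_apply]
  field_simp

theorem bound_of_deriv_bound {F F' : ℝ → ℝ} (k : ℕ) (C : ℝ)
    (hC : 0 ≤ C) (T : ℝ) (h0 : F 0 = 0) (hF : ContinuousOn F (Icc 0 T))
    (hd : ∀ t ∈ Ico 0 T, HasDerivWithinAt F (F' t) (Ici t) t)
    (hb : ∀ t ∈ Ico 0 T, |F' t| ≤ C * (t * ((t ^ 2) ^ k / k.factorial))) :
    ∀ t ∈ Icc 0 T, |F t| ≤ C * ((t ^ 2) ^ (k + 1) / (k + 1).factorial) := by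
  intro t ht
  refine image_norm_le_of_norm_deriv_right_le_deriv_boundary (f := F) (f' := F') hF hd
    (B := fun x => C * ((x ^ 2) ^ (k + 1) / (k + 1).factorial)) ?_
    (fun x => (int_odd_pow k x).const_mul C) ?_ ht
  · simp [h0]
  · intro x hx
    refine (hb x hx).trans ?_
    have : 0 ≤ x * ((x ^ 2) ^ k / (k.factorial : ℝ)) := by
      have := hx.1
      positivity
    nlinarith [mul_nonneg hC this]

theorem approx_spec {w : ℝ → ℝ} (hw : Continuous w) (hpos : ∀ t, t ≠ 0 → 0 < w t)
    (hmono : ∀ s t, |s| ≤ |t| → w s ≤ w t) (h0 : 0 ≤ w 0) (k : ℕ) :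
    Continuous (approx w k) ∧ (∀ t, approx w k (-t) = approx w k t) ∧
      ∀ t, |approx w k t| ≤ (t ^ 2) ^ k / k.factorial := by
  have heven : ∀ t, w (-t) = w t := fun t =>
    le_antisymm (hmono _ _ (by simp)) (hmono _ _ (by simp))
  induction k with
  | zero => exact ⟨continuous_const, fun _ => rfl, fun t => by simp [approx]⟩
  | succ k ih =>
    obtain ⟨hc, he, hb⟩ := ih
    have hg := inner_continuous hw hpos hmono h0 k hc hb
    have hgb := inner_bound hpos hmono h0 k hb
    have hcont : Continuous (approx w (k + 1)) :=
      intervalIntegral.continuous_primitive (fun a b => hg.intervalIntegrable a b) 0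
    have hodd : ∀ s, inner w (approx w k) (-s) = -inner w (approx w k) s := by
      intro s
      have h := intervalIntegral.integral_comp_neg (a := (0 : ℝ)) (b := s)
        (fun r => w r * approx w k r)
      simp only [heven, he, neg_zero] at h
      rw [inner, inner, heven, h, intervalIntegral.integral_symm, mul_neg]
    have heven' : ∀ t, approx w (k + 1) (-t) = approx w (k + 1) t := by
      intro t
      have h := intervalIntegral.integral_comp_neg (a := (0 : ℝ)) (b := t)
        (inner w (approx w k))
      simp only [hodd, neg_zero, intervalIntegral.integral_neg] at h
      change ∫ s in (0 : ℝ)..(-t), inner w (approx w k) s = ∫ s in (0 : ℝ)..t, _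
      rw [intervalIntegral.integral_symm, ← h, neg_neg]
    refine ⟨hcont, heven', ?_⟩
    have hpart : ∀ t, 0 ≤ t → |approx w (k + 1) t| ≤ (t ^ 2) ^ (k + 1) / (k + 1).factorial := by
      intro t ht
      have := bound_of_deriv_bound (F := approx w (k + 1)) (F' := inner w (approx w k)) k 1
        zero_le_one t (by simp [approx]) hcont.continuousOn
        (fun x _ => (hg.integral_hasStrictDerivAt 0 x).hasDerivAt.hasDerivWithinAt)
        (fun x hx => by
          have := hgb x
          rwa [abs_of_nonneg hx.1, ← one_mul (x * _)] at this) t ⟨ht, le_rfl⟩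
      simpa using this
    intro t
    rcases le_total 0 t with ht | ht
    · exact hpart t ht
    · have := hpart (-t) (by linarith)
      rwa [heven', neg_sq] at this

theorem exists_solution {w : ℝ → ℝ} (hw : Continuous w) (hpos : ∀ t, t ≠ 0 → 0 < w t)
    (hmono : ∀ s t, |s| ≤ |t| → w s ≤ w t) (h0 : 0 ≤ w 0) (μ : ℝ) :
    ∃ f D : ℝ → ℝ, (∀ t, f (-t) = f t) ∧ f 0 = 1 ∧ (∀ t, HasDerivAt f (D t) t) ∧ D 0 = 0 ∧
      ∀ t, 0 < t → HasDerivAt (fun s => w s * D s) (-(μ * w t * f t)) t := by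
  have hs := approx_spec hw hpos hmono h0
  have hwn : ∀ s, 0 ≤ w s := fun s => by
    by_cases hs : s = 0
    · rw [hs]; exact h0
    · exact (hpos s hs).le
  obtain ⟨g, hgdef⟩ : ∃ g : ℕ → ℝ → ℝ, g = fun k => inner w (approx w k) := ⟨_, rfl⟩
  have hgc : ∀ k, Continuous (g k) := fun k => by
    rw [hgdef]
    exact inner_continuous hw hpos hmono h0 k (hs k).1 (hs k).2.2
  have hgb : ∀ k t, |g k t| ≤ |t| * ((t ^ 2) ^ k / k.factorial) := fun k => by
    rw [hgdef]
    exact inner_bound hpos hmono h0 k (hs k).2.2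
  have hgd : ∀ k t, HasDerivAt (approx w (k + 1)) (g k t) t := fun k t => by
    have h := ((hgc k).integral_hasStrictDerivAt 0 t).hasDerivAt
    rw [hgdef] at h ⊢
    exact h
  have hsumT : ∀ T C : ℝ, Summable (fun k : ℕ => C * ((|μ| * T ^ 2) ^ k / k.factorial)) :=
    fun T C => (Real.summable_pow_div_factorial _).mul_left C
  have hterm : ∀ (k : ℕ) (T t : ℝ), |t| ≤ T →
      |μ| ^ (k + 1) * ((t ^ 2) ^ k / k.factorial) ≤ |μ| * ((|μ| * T ^ 2) ^ k / k.factorial) := by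
    intro k T t ht
    have h2 : t ^ 2 ≤ T ^ 2 := by
      rw [← sq_abs t]; exact pow_le_pow_left₀ (abs_nonneg t) ht 2
    calc |μ| ^ (k + 1) * ((t ^ 2) ^ k / k.factorial)
        ≤ |μ| ^ (k + 1) * ((T ^ 2) ^ k / k.factorial) := by gcongr
      _ = _ := by rw [mul_pow]; ring
  have hsumA : ∀ t, Summable (fun k => (-μ) ^ (k + 1) * approx w (k + 1) t) := by
    intro t
    have h1 : Summable (fun k => (-μ) ^ k * approx w k t) := by
      refine Summable.of_norm_bounded (hsumT t 1) (fun k => ?_)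
      rw [Real.norm_eq_abs, abs_mul, abs_pow, abs_neg, mul_pow, one_mul, mul_div_assoc]
      gcongr
      exact (hs k).2.2 t
    exact (summable_nat_add_iff (f := fun k => (-μ) ^ k * approx w k t) 1).2 h1
  refine ⟨fun t => 1 + ∑' k, (-μ) ^ (k + 1) * approx w (k + 1) t,
    fun t => ∑' k, (-μ) ^ (k + 1) * g k t, ?_, ?_, ?_, ?_, ?_⟩
  · intro t
    simp only [(hs _).2.1]
  · have : ∀ k, approx w (k + 1) 0 = 0 := fun k => by simp [approx]
    simp [this]
  · intro t
    refine HasDerivAt.const_add 1 ?_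
    refine hasDerivAt_tsum_of_isPreconnected
      (g := fun k s => (-μ) ^ (k + 1) * approx w (k + 1) s)
      (g' := fun k s => (-μ) ^ (k + 1) * g k s)
      (u := fun k : ℕ => ((|t| + 1) * |μ|) * ((|μ| * (|t| + 1) ^ 2) ^ k / k.factorial))
      (t := Ioo (-(|t| + 1)) (|t| + 1)) (y₀ := t) (hsumT _ _) isOpen_Ioo isPreconnected_Ioo
      ?_ ?_ ?_ (hsumA t) ?_
    · intro k y _
      exact (hgd k y).const_mul ((-μ) ^ (k + 1))
    · intro k y hy
      have hy' : |y| ≤ |t| + 1 := (abs_lt.2 hy).le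
      rw [Real.norm_eq_abs, abs_mul, abs_pow, abs_neg]
      calc |μ| ^ (k + 1) * |g k y| ≤ |μ| ^ (k + 1) * (|y| * ((y ^ 2) ^ k / k.factorial)) := by
            gcongr; exact hgb k y
        _ = |y| * (|μ| ^ (k + 1) * ((y ^ 2) ^ k / k.factorial)) := by ring
        _ ≤ (|t| + 1) * (|μ| * ((|μ| * (|t| + 1) ^ 2) ^ k / k.factorial)) :=
            mul_le_mul hy' (hterm k _ y hy') (by positivity) (by positivity)
        _ = _ := by ring
    · exact abs_lt.1 (by linarith)
    · exact abs_lt.1 (by linarith)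
  · have : ∀ k, g k 0 = 0 := fun k => by simp [hgdef, inner]
    simp [this]
  · intro t ht
    have hV : HasDerivAt (fun s => ∑' k, (-μ) ^ (k + 1) * ∫ r in (0 : ℝ)..s, w r * approx w k r)
        (∑' k, (-μ) ^ (k + 1) * (w t * approx w k t)) t := by
      refine hasDerivAt_tsum_of_isPreconnected
        (g := fun k s => (-μ) ^ (k + 1) * ∫ r in (0 : ℝ)..s, w r * approx w k r)
        (g' := fun k s => (-μ) ^ (k + 1) * (w s * approx w k s))
        (u := fun k : ℕ => (w (t + 1) * |μ|) * ((|μ| * (t + 1) ^ 2) ^ k / k.factorial))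
        (t := Ioo (-(t + 1)) (t + 1)) (y₀ := 0) (hsumT _ _) isOpen_Ioo isPreconnected_Ioo
        ?_ ?_ ?_ ?_ ?_
      · intro k y _
        exact ((hw.mul (hs k).1).integral_hasStrictDerivAt 0 y).hasDerivAt.const_mul _
      · intro k y hy
        have hy' : |y| ≤ t + 1 := (abs_lt.2 hy).le
        rw [Real.norm_eq_abs, abs_mul, abs_pow, abs_neg, abs_mul, abs_of_nonneg (hwn y)]
        have hyw : w y ≤ w (t + 1) := hmono _ _ (by rwa [abs_of_pos (by linarith : 0 < t + 1)])
        calc |μ| ^ (k + 1) * (w y * |approx w k y|)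
            ≤ |μ| ^ (k + 1) * (w y * ((y ^ 2) ^ k / k.factorial)) := by
              have := hwn y
              gcongr; exact (hs k).2.2 y
          _ = w y * (|μ| ^ (k + 1) * ((y ^ 2) ^ k / k.factorial)) := by ring
          _ ≤ w (t + 1) * (|μ| * ((|μ| * (t + 1) ^ 2) ^ k / k.factorial)) :=
              mul_le_mul hyw (hterm k _ y hy') (by positivity) (hwn _)
          _ = _ := by ring
      · constructor <;> linarith
      · simp
      · constructor <;> linarith
    have hval : ∑' k, (-μ) ^ (k + 1) * (w t * approx w k t) =
        -(μ * w t * (1 + ∑' k, (-μ) ^ (k + 1) * approx w (k + 1) t)) := by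
      have h1 : ∑' k, (-μ) ^ k * approx w k t =
          1 + ∑' k, (-μ) ^ (k + 1) * approx w (k + 1) t := by
        rw [((summable_nat_add_iff (f := fun k => (-μ) ^ k * approx w k t) 1).1
          (hsumA t)).tsum_eq_zero_add]
        simp [approx]
      rw [← h1, ← neg_mul, ← tsum_mul_left]
      exact tsum_congr fun k => by ring
    rw [hval] at hV
    refine hV.congr_of_eventuallyEq ?_
    filter_upwards [lt_mem_nhds ht] with s hs'
    rw [← tsum_mul_left]
    refine tsum_congr fun k => ?_
    simp only [hgdef, inner]
    have := (hpos s hs'.ne').ne'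
    field_simp

theorem unique_solution {w : ℝ → ℝ} (hpos : ∀ t, t ≠ 0 → 0 < w t)
    (hmono : ∀ s t, |s| ≤ |t| → w s ≤ w t) (μ : ℝ) {d D : ℝ → ℝ}
    (h0 : d 0 = 0) (hd0 : HasDerivAt d 0 0) (hd : ∀ t, 0 < t → HasDerivAt d (D t) t)
    (hode : ∀ t, 0 < t → HasDerivAt (fun s => w s * D s) (-(μ * w t * d t)) t) :
    ∀ T, 0 < T → d T = 0 := by
  intro T hT
  have hdc : ContinuousOn d (Icc 0 T) := by
    intro t ht
    rcases ht.1.eq_or_lt with h | h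
    · exact (h ▸ hd0.continuousAt).continuousWithinAt
    · exact (hd t h).continuousAt.continuousWithinAt
  obtain ⟨M, hM⟩ := isCompact_Icc.exists_bound_of_continuousOn hdc
  have hM0 : 0 ≤ M := (norm_nonneg _).trans (hM 0 ⟨le_rfl, hT.le⟩)
  -- a bound on `d` yields a bound on its derivative
  have step : ∀ (B : ℝ → ℝ), (∀ s t, 0 ≤ s → s ≤ t → B s ≤ B t) →
      (∀ t ∈ Icc 0 T, |d t| ≤ B t) → ∀ t ∈ Ioc 0 T, |D t| ≤ |μ| * (t * B t) := by
    intro B hB hdB t ht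
    have hB0 : 0 ≤ B t := (abs_nonneg _).trans (hdB t ⟨ht.1.le, ht.2⟩)
    have hwt := hpos t ht.1.ne'
    have main : ∀ ε > 0, w t * |D t| ≤ |μ| * (w t * B t) * t + w t * ε := by
      intro ε hε
      have hsl := hd0.isLittleO.def hε
      simp only [h0, sub_zero, smul_zero, Real.norm_eq_abs] at hsl
      obtain ⟨δ, hδ, hball⟩ := Metric.eventually_nhds_iff.1 hsl
      set s := min (δ / 2) (t / 2) with hsdef
      have hs0 : 0 < s := lt_min (by linarith) (by linarith [ht.1])
      have hst : s < t := (min_le_right _ _).trans_lt (by linarith [ht.1])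
      have hds : |d s| ≤ ε * s := by
        have := hball (y := s) (by
          rw [Real.dist_eq, sub_zero, abs_of_pos hs0]
          exact (min_le_left _ _).trans_lt (by linarith))
        rwa [abs_of_pos hs0] at this
      obtain ⟨ξ, hξ, hξe⟩ := exists_hasDerivAt_eq_slope d D hs0
        (hdc.mono (Icc_subset_Icc le_rfl (hst.le.trans ht.2))) (fun x hx => hd x hx.1)
      have hDξ : |D ξ| ≤ ε := by
        rw [hξe, h0, sub_zero, sub_zero, abs_div, abs_of_pos hs0, div_le_iff₀ hs0]
        exact hds
      have hξt : ξ < t := hξ.2.trans hst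
      have hwξ : w ξ ≤ w t := hmono _ _ (by
        rw [abs_of_pos hξ.1, abs_of_pos ht.1]; exact hξt.le)
      have hmv := norm_image_sub_le_of_norm_deriv_le_segment' (f := fun s => w s * D s)
        (f' := fun s => -(μ * w s * d s)) (a := ξ) (b := t) (C := |μ| * (w t * B t))
        (fun x hx => (hode x (hξ.1.trans_le hx.1)).hasDerivWithinAt)
        (fun x hx => by
          have hx0 : 0 < x := hξ.1.trans_le hx.1
          have hwx : w x ≤ w t := hmono _ _ (by
            rw [abs_of_pos hx0, abs_of_pos ht.1]; exact hx.2.le)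
          rw [Real.norm_eq_abs, abs_neg, mul_assoc, abs_mul, abs_mul,
            abs_of_pos (hpos x hx0.ne')]
          refine mul_le_mul_of_nonneg_left ?_ (abs_nonneg μ)
          exact mul_le_mul hwx ((hdB x ⟨hx0.le, hx.2.le.trans ht.2⟩).trans
            (hB x t hx0.le hx.2.le)) (abs_nonneg _) hwt.le) t ⟨hξt.le, le_rfl⟩
      rw [Real.norm_eq_abs] at hmv
      have h1 : |w t * D t| ≤ |w t * D t - w ξ * D ξ| + |w ξ * D ξ| := by
        have := abs_add_le (w t * D t - w ξ * D ξ) (w ξ * D ξ)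
        rwa [sub_add_cancel] at this
      have h2 : |w ξ * D ξ| ≤ w t * ε := by
        rw [abs_mul, abs_of_pos (hpos ξ hξ.1.ne')]
        exact mul_le_mul hwξ hDξ (abs_nonneg _) hwt.le
      rw [abs_mul (w t), abs_of_pos hwt] at h1
      have h3 : |μ| * (w t * B t) * (t - ξ) ≤ |μ| * (w t * B t) * t :=
        mul_le_mul_of_nonneg_left (by linarith [hξ.1]) (by positivity)
      linarith
    refine le_of_forall_pos_le_add fun ε hε => ?_
    have := main ε hε
    refine le_of_mul_le_mul_left (a := w t) ?_ hwt
    linarith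
  have iter : ∀ k : ℕ, ∀ t ∈ Icc 0 T, |d t| ≤ (M * |μ| ^ k) * ((t ^ 2) ^ k / k.factorial) := by
    intro k
    induction k with
    | zero => intro t ht; simpa using hM t ht
    | succ k ih =>
      have hst := step (fun t => (M * |μ| ^ k) * ((t ^ 2) ^ k / k.factorial))
        (fun s t hs hst => by gcongr) ih
      set D' : ℝ → ℝ := fun t => if t = 0 then 0 else D t with hD'
      refine bound_of_deriv_bound (F := d) (F' := D') k _ (by positivity) T h0 hdc ?_ ?_
      · intro t ht
        rcases ht.1.eq_or_lt with h | h
        · rw [← h]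
          simpa [hD'] using hd0.hasDerivWithinAt
        · simpa [hD', h.ne'] using (hd t h).hasDerivWithinAt
      · intro t ht
        rcases ht.1.eq_or_lt with h | h
        · rw [← h]; simp [hD']
        · simp only [hD', h.ne', if_false]
          refine (hst t ⟨h, ht.2.le⟩).trans (le_of_eq ?_)
          ring
  have hlim : Tendsto (fun k : ℕ => M * ((|μ| * T ^ 2) ^ k / k.factorial)) atTop (𝓝 0) := by
    simpa using (FloorSemiring.tendsto_pow_div_factorial_atTop (|μ| * T ^ 2)).const_mul M
  have hle : |d T| ≤ 0 := ge_of_tendsto' hlim fun k => by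
    refine (iter k T ⟨hT.le, le_rfl⟩).trans (le_of_eq ?_)
    rw [mul_pow]; ring
  exact abs_eq_zero.1 (le_antisymm hle (abs_nonneg _))

theorem weight_aux {α β : ℝ} (hβ : -1 / 2 ≤ β) (hα : -1 / 2 < α) :
    Continuous (fun t => jacobiWeight α β |t|) ∧ (∀ t, t ≠ 0 → 0 < jacobiWeight α β |t|) ∧
      (∀ s t, |s| ≤ |t| → jacobiWeight α β |s| ≤ jacobiWeight α β |t|) ∧
      0 ≤ jacobiWeight α β |0| := by
  have ha : 0 < 2 * α + 1 := by linarith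
  have hb : 0 ≤ 2 * β + 1 := by linarith
  refine ⟨?_, ?_, ?_, ?_⟩
  · unfold jacobiWeight
    refine (continuous_const.mul ?_).mul ?_
    · exact (Real.continuous_rpow_const ha.le).comp (Real.continuous_sinh.comp continuous_abs)
    · exact (Real.continuous_rpow_const hb).comp (Real.continuous_cosh.comp continuous_abs)
  · intro t ht
    have h1 : 0 < Real.sinh |t| := Real.sinh_pos_iff.2 (abs_pos.2 ht)
    have h2 := Real.cosh_pos |t|
    unfold jacobiWeight
    positivity
  · intro s t hst
    have h1 : 0 ≤ Real.sinh |s| := Real.sinh_nonneg_iff.2 (abs_nonneg s)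
    have h2 := Real.cosh_pos |s|
    have h3 : Real.sinh |s| ≤ Real.sinh |t| := Real.sinh_le_sinh.2 hst
    have h4 : Real.cosh |s| ≤ Real.cosh |t| := Real.cosh_le_cosh.2 (by simpa using hst)
    unfold jacobiWeight
    have := h1.trans h3
    gcongr
  · simp [jacobiWeight, Real.zero_rpow ha.ne']

end JacobiAux

/-- The Sturm–Liouville problem has a solution, and `jacobiPhi` is one. -/
theorem jacobiPhi_spec {α β : ℝ} (hβ : -1 / 2 ≤ β) (hα : -1 / 2 < α) (lam : ℝ) :
    IsJacobiFunction α β lam (jacobiPhi α β lam) := by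
  obtain ⟨h1, h2, h3, h4⟩ := JacobiAux.weight_aux hβ hα
  obtain ⟨f, D, he, hf0, hd, hD0, ho⟩ := JacobiAux.exists_solution h1 h2 h3 h4
    (lam ^ 2 + jacobiRho α β ^ 2)
  refine Classical.epsilon_spec (p := IsJacobiFunction α β lam)
    ⟨f, he, hf0, by simpa [hD0] using hd 0, fun t _ => (hd t).differentiableAt, fun t ht => ?_⟩
  have h := ho t ht
  rw [abs_of_pos ht] at h
  refine h.congr_of_eventuallyEq ?_
  filter_upwards [lt_mem_nhds ht] with s hs
  rw [(hd s).deriv, abs_of_pos hs]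

/-- The solution of the Sturm–Liouville problem is unique. -/
theorem IsJacobiFunction.eq_jacobiPhi {α β lam : ℝ} (hβ : -1 / 2 ≤ β) (hα : -1 / 2 < α)
    {φ : ℝ → ℝ} (h : IsJacobiFunction α β lam φ) : φ = jacobiPhi α β lam := by
  obtain ⟨_, h2, h3, _⟩ := JacobiAux.weight_aux hβ hα
  have g := jacobiPhi_spec hβ hα lam
  have key := JacobiAux.unique_solution h2 h3 (lam ^ 2 + jacobiRho α β ^ 2)
    (d := fun t => φ t - jacobiPhi α β lam t)
    (D := fun t => deriv φ t - deriv (jacobiPhi α β lam) t)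
    (by simp [h.map_zero, g.map_zero])
    ((h.deriv_zero.sub g.deriv_zero).congr_deriv (sub_zero 0))
    (fun t ht => (h.differentiable t ht).hasDerivAt.sub (g.differentiable t ht).hasDerivAt)
    (fun t ht => by
      have e := (h.ode t ht).sub (g.ode t ht)
      refine (e.congr_of_eventuallyEq ?_).congr_deriv ?_
      · filter_upwards [lt_mem_nhds ht] with s hs
        simp only [abs_of_pos hs, Pi.sub_apply]
        ring
      · rw [abs_of_pos ht]; ring)
  funext t
  rcases lt_trichotomy t 0 with ht | ht | ht
  · rw [← h.even, ← g.even]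
    exact sub_eq_zero.1 (key (-t) (by linarith))
  · rw [ht, h.map_zero, g.map_zero]
  · exact sub_eq_zero.1 (key t ht)

/-- The normalized Jacobi function `ψ_lam(t) = φ_lam(t) / φ_0(t)`. -/
noncomputable def jacobiPsi (α β lam t : ℝ) : ℝ := jacobiPhi α β lam t / jacobiPhi α β 0 t

/-- The elements of a set `S` of reals listed in increasing order: the least element, the least
element above that one, and so on, see `nthSmallest_eq`. -/
noncomputable def nthSmallest (S : Set ℝ) : ℕ → ℝ
  | 0 => sInf S
  | k + 1 => sInf {x | x ∈ S ∧ nthSmallest S k < x}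

/-- If `S` is the set of values of a strictly increasing sequence, `nthSmallest S` is it. -/
theorem nthSmallest_eq {S : Set ℝ} {l : ℕ → ℝ} (hl : StrictMono l) (hS : Set.range l = S) :
    nthSmallest S = l := by
  subst hS
  funext k
  induction k with
  | zero =>
    refine IsLeast.csInf_eq ⟨⟨0, rfl⟩, ?_⟩
    rintro _ ⟨j, rfl⟩
    exact hl.monotone (Nat.zero_le j)
  | succ k ih =>
    refine IsLeast.csInf_eq ⟨⟨⟨k + 1, rfl⟩, ?_⟩, ?_⟩
    · rw [ih]; exact hl (Nat.lt_succ_self k)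
    · rintro _ ⟨⟨j, rfl⟩, hj⟩
      rw [ih] at hj
      exact hl.monotone (hl.lt_iff_lt.1 hj)

/-- `jacobiZero α β τ k` is `λ_{k+1}(τ)`: the positive zeros `λ_1(τ) < λ_2(τ) < ⋯` of
`lam ↦ φ_lam(τ)`, numbered here from `k = 0`. -/
noncomputable def jacobiZero (α β τ : ℝ) (k : ℕ) : ℝ :=
  nthSmallest {lam | 0 < lam ∧ jacobiPhi α β lam τ = 0} k

/-- `jacobiZeroStar α β τ k` is `λ*_{k+1}(τ)`: the positive zeros `λ*_1(τ) < λ*_2(τ) < ⋯` of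
`lam ↦ ψ'_lam(τ)` (derivative in the variable `t`), numbered here from `k = 0`. -/
noncomputable def jacobiZeroStar (α β τ : ℝ) (k : ℕ) : ℝ :=
  nthSmallest {lam | 0 < lam ∧ deriv (jacobiPsi α β lam) τ = 0} k

/-- The multiplicity of `t` as a zero of `p`: the supremum of the `m` such that
`p, p', …, p^{(m-1)}` vanish at `t` (so it is `0` where `p` does not vanish). -/
noncomputable def zeroMultiplicity (p : ℝ → ℝ) (t : ℝ) : ℕ∞ :=
  ⨆ (m : ℕ) (_ : ∀ j < m, iteratedDeriv j p t = 0), (m : ℕ∞)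

open Classical in
/-- The contribution of the point `t` of the interval `I` to the number of zeros of `p`:
zeros in the interior of `I` count with multiplicity, a zero at an endpoint counts once. -/
noncomputable def zeroWeight (I : Set ℝ) (p : ℝ → ℝ) (t : ℝ) : ℕ∞ :=
  if t ∈ interior I then zeroMultiplicity p t else if p t = 0 then 1 else 0

/-- The number `N_I(p)` of zeros of `p` on the interval `I`. -/
noncomputable def zeroCount (I : Set ℝ) (p : ℝ → ℝ) : ℕ∞ :=
  ⨆ (F : Finset ℝ) (_ : (F : Set ℝ) ⊆ I), ∑ t ∈ F, zeroWeight I p t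

/-- `f 0, f 1, …` is a Chebyshev system on `I`: every nontrivial linear combination `p` of the
first `n` functions satisfies `N_I(p) ≤ n - 1`, that is `N_I(p) < n`. -/
def IsChebyshevSystem (f : ℕ → ℝ → ℝ) (I : Set ℝ) : Prop :=
  ∀ (n : ℕ) (A : ℕ → ℝ), (∃ k < n, A k ≠ 0) →
    zeroCount I (fun t => ∑ k ∈ Finset.range n, A k * f k t) < (n : ℕ∞)

/-- The family `{1} ∪ {f 0, f 1, …}`, in this order. -/
def consOne (f : ℕ → ℝ → ℝ) : ℕ → ℝ → ℝ
  | 0 => fun _ => 1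
  | k + 1 => f k

open Filter Topology Set
open scoped ContDiff Finset

/-!
The quotients `ψ_x = φ_x / φ_0` solve `w⁻¹ (w ψ')' = -x² ψ` for the weight `w = Δ φ_0²`. This weight
is increasing: `φ_0 exp(ρ t)` is increasing because `exp(-ρ t)` is a supersolution of the equation
of `φ_0`, and `Δ exp(-2 ρ t)` is increasing because `Δ' / Δ ≥ 2 ρ`.

For solutions of such an equation the Chebyshev property is Sturm's argument. Apply the operator
`w⁻¹ ∂ₜ w ∂ₜ` repeatedly to a combination `p = ∑ a_k ψ_{x_k}` whose modes satisfy a boundary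
condition at `τ`. By Rolle's theorem, with the boundary conditions at `0` and `τ` supplying the
zeros that each differentiation would lose, the number of zeros does not decrease. The `k`-th
coefficient is multiplied by `-x_k²` each time, so after rescaling the iterates converge to the
leading mode `ψ_{x_q}`, which therefore has at least as many zeros as `p`. As the parameter grows
from `0` to `x_q`, a zero of the mode can enter `(0, τ]` only through `τ`, hence the leading mode
has at most as many zeros as there are parameters in `(0, x_q]` satisfying the boundary condition.
-/

namespace SturmLiouville

section Rolle

theorem exists_finset_interlacing {X : Type*} [LinearOrder X] {P : X → Prop} (Z : Finset X)
    (h : ∀ a ∈ Z, ∀ b ∈ Z, a < b → ∃ s ∈ Ioo a b, P s) :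
    ∃ G : Finset X, #Z ≤ #G + 1 ∧ Disjoint Z G ∧ ∀ s ∈ G, P s ∧ ∃ a ∈ Z, ∃ b ∈ Z, s ∈ Ioo a b := by
  induction Z using Finset.induction_on_max with
  | empty => exact ⟨∅, by simp⟩
  | insert b F hb ih =>
    obtain ⟨G, hcard, hdisj, hG⟩ := ih fun a ha c hc =>
      h a (Finset.mem_insert_of_mem ha) c (Finset.mem_insert_of_mem hc)
    rcases F.eq_empty_or_nonempty with rfl | hF
    · exact ⟨∅, by simp⟩
    have hmax := F.max'_mem hF
    obtain ⟨s, hs, hPs⟩ := h _ (Finset.mem_insert_of_mem hmax) b (Finset.mem_insert_self b F)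
      (hb _ hmax)
    have hF_lt : ∀ a ∈ F, a < s := fun a ha => (F.le_max' a ha).trans_lt hs.1
    have hG_lt : ∀ g ∈ G, g < s := fun g hg => by
      obtain ⟨-, _, -, c, hc, hgc⟩ := hG g hg
      exact hgc.2.trans (hF_lt c hc)
    refine ⟨insert s G, ?_, ?_, ?_⟩
    · rw [Finset.card_insert_of_notMem fun hbF => lt_irrefl b (hb b hbF),
        Finset.card_insert_of_notMem fun hsG => lt_irrefl s (hG_lt s hsG)]
      gcongr
    · rw [Finset.disjoint_insert_left, Finset.disjoint_insert_right, Finset.mem_insert, not_or]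
      exact ⟨⟨hs.2.ne', fun hbG => (hG_lt b hbG).not_gt hs.2⟩,
        fun hsF => lt_irrefl s (hF_lt s hsF), hdisj⟩
    · rw [Finset.forall_mem_insert]
      refine ⟨⟨hPs, _, Finset.mem_insert_of_mem hmax, b, Finset.mem_insert_self b F, hs⟩,
        fun g hg => ?_⟩
      obtain ⟨hPg, a, ha, c, hc, hgac⟩ := hG g hg
      exact ⟨hPg, a, Finset.mem_insert_of_mem ha, c, Finset.mem_insert_of_mem hc, hgac⟩

/-- A sequence of functions each of which is, up to a nonvanishing smooth factor, the derivative
of its predecessor on `(0, ∞)`. -/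
structure IsQuasiDerivSeq (R c : ℕ → ℝ → ℝ) : Prop where
  continuous : ∀ i, Continuous (R i)
  hasDerivAt : ∀ i t, 0 < t → HasDerivAt (R i) (c i t * R (i + 1) t) t
  ne_zero : ∀ i t, 0 < t → c i t ≠ 0
  contDiffOn_factor : ∀ i, ContDiffOn ℝ ∞ (c i) (Ioi 0)

/-- The points of `s` are zeros of `D 0`, with multiplicities measured along the sequence `D`: a
point of multiplicity `m` in `s` is a zero of `D 0, …, D (m - 1)`. -/
def IsZeroMultiset (D : ℕ → ℝ → ℝ) (s : Multiset ℝ) : Prop :=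
  ∀ a, ∀ j < s.count a, D j a = 0

/-- `R i` has at least `N` zeros in `(0, τ)`, with multiplicities measured along the sequence
`R i, R (i + 1), …`. -/
def HasInteriorZeros (R : ℕ → ℝ → ℝ) (τ : ℝ) (i N : ℕ) : Prop :=
  ∃ s : Multiset ℝ, N ≤ s.card ∧ (∀ a ∈ s, a ∈ Ioo 0 τ) ∧ IsZeroMultiset (fun j => R (i + j)) s

variable {R c : ℕ → ℝ → ℝ} {τ a b : ℝ} {i M N : ℕ} {s : Multiset ℝ} {E : Finset ℝ}

theorem IsQuasiDerivSeq.exists_zero_between (hR : IsQuasiDerivSeq R c) (ha : 0 ≤ a) (hab : a < b)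
    (hRa : R i a = 0) (hRb : R i b = 0) : ∃ t ∈ Ioo a b, R (i + 1) t = 0 := by
  have hpos : ∀ t ∈ Ioo a b, 0 < t := fun t ht => ha.trans_lt ht.1
  obtain ⟨t, ht, ht0⟩ := exists_hasDerivAt_eq_zero hab (hR.continuous i).continuousOn
    (hRa.trans hRb.symm) fun t ht => hR.hasDerivAt i t (hpos t ht)
  exact ⟨t, ht, (mul_eq_zero.1 ht0).resolve_left (hR.ne_zero i t (hpos t ht))⟩

theorem IsZeroMultiset.eq_zero_of_mem {D : ℕ → ℝ → ℝ} (h : IsZeroMultiset D s) (ha : a ∈ s) :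
    D 0 a = 0 :=
  h a 0 (Multiset.count_pos.2 ha)

theorem HasInteriorZeros.rolle (hR : IsQuasiDerivSeq R c) (hτ : 0 < τ)
    (h : HasInteriorZeros R τ i N) (hE : ∀ e ∈ E, (e = 0 ∨ e = τ) ∧ R i e = 0)
    (hM : M + 1 ≤ N + #E) : HasInteriorZeros R τ (i + 1) M := by
  obtain ⟨s, hN, hs, hzero⟩ := h
  have hE_mem : ∀ e ∈ E, e ∈ Icc 0 τ ∧ e ∉ Ioo 0 τ := fun e he => by
    rcases (hE e he).1 with rfl | rfl <;> simp [hτ.le]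
  have hZ : ∀ z ∈ s.toFinset ∪ E, z ∈ Icc 0 τ ∧ R i z = 0 := fun z hz => by
    rcases Finset.mem_union.1 hz with hz | hz
    · rw [Multiset.mem_toFinset] at hz
      exact ⟨Ioo_subset_Icc_self (hs z hz), hzero.eq_zero_of_mem hz⟩
    · exact ⟨(hE_mem z hz).1, (hE z hz).2⟩
  obtain ⟨G, hcard, hdisj, hG⟩ := exists_finset_interlacing (s.toFinset ∪ E)
    fun a ha b hb hab => hR.exists_zero_between (hZ a ha).1.1 hab (hZ a ha).2 (hZ b hb).2
  have hsG : ∀ a ∈ s, a ∉ G := fun a ha => Finset.disjoint_left.1 hdisj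
    (Finset.mem_union_left E (Multiset.mem_toFinset.2 ha))
  refine ⟨s - s.dedup + G.val, ?_, fun a ha => ?_, fun a j hj => ?_⟩
  · have hsE : Disjoint s.toFinset E := Finset.disjoint_left.2 fun a ha haE =>
      (hE_mem a haE).2 (hs a (Multiset.mem_toFinset.1 ha))
    rw [Finset.card_union_of_disjoint hsE, Multiset.card_toFinset] at hcard
    have hle := Multiset.card_le_card (Multiset.dedup_le s)
    rw [Multiset.card_add, Multiset.card_sub (Multiset.dedup_le s), Finset.card_val]
    omega
  · rcases Multiset.mem_add.1 ha with ha | ha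
    · exact hs a (Multiset.mem_of_le (Multiset.sub_le_self _ _) ha)
    · obtain ⟨-, x, hx, y, hy, haxy⟩ := hG a ha
      exact ⟨(hZ x hx).1.1.trans_lt haxy.1, haxy.2.trans_le (hZ y hy).1.2⟩
  · rw [Multiset.count_add, Multiset.count_sub, Multiset.count_dedup] at hj
    by_cases has : a ∈ s
    · rw [if_pos has, Multiset.count_eq_zero_of_notMem (hsG a has)] at hj
      change R (i + 1 + j) a = 0
      rw [add_right_comm]
      exact hzero a (j + 1) (by omega)
    · have hjG : j < G.val.count a := by simpa [has] using hj
      have hj1 := hjG.trans_le (Multiset.nodup_iff_count_le_one.1 G.nodup a)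
      obtain rfl : j = 0 := by omega
      exact (hG a (Multiset.count_pos.1 hjG)).1

end Rolle

section Multiplicity

variable {R c : ℕ → ℝ → ℝ} {τ a : ℝ} {i M N : ℕ} {I : Set ℝ} {p : ℝ → ℝ}

theorem IsQuasiDerivSeq.contDiffOn (hR : IsQuasiDerivSeq R c) (i : ℕ) :
    ContDiffOn ℝ ∞ (R i) (Ioi 0) := by
  refine contDiffOn_infty.2 fun n => ?_
  induction n generalizing i with
  | zero => exact contDiffOn_zero.2 (hR.continuous i).continuousOn
  | succ n ih =>
    rw [Nat.cast_succ, contDiffOn_succ_iff_deriv_of_isOpen isOpen_Ioi]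
    refine ⟨fun t ht => (hR.hasDerivAt i t ht).differentiableAt.differentiableWithinAt,
      fun h => absurd h (by simp), ?_⟩
    exact ((contDiffOn_infty.1 (hR.contDiffOn_factor i) n).mul (ih (i + 1))).congr
      fun t ht => (hR.hasDerivAt i t ht).deriv

theorem iteratedDeriv_mul_eq_zero {f g : ℝ → ℝ} {m : ℕ} (hf : ContDiffAt ℝ ∞ f a)
    (hg : ContDiffAt ℝ ∞ g a) (h : ∀ j < m, iteratedDeriv j g a = 0) :
    ∀ j < m, iteratedDeriv j (fun x => f x * g x) a = 0 := by
  intro j hj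
  rw [iteratedDeriv_fun_mul (hf.of_le (by exact_mod_cast le_top))
    (hg.of_le (by exact_mod_cast le_top))]
  refine Finset.sum_eq_zero fun l _ => ?_
  rw [h (j - l) (by omega), mul_zero]

theorem IsQuasiDerivSeq.iteratedDeriv_succ_eq_zero (hR : IsQuasiDerivSeq R c) (ha : 0 < a) {m : ℕ}
    (h : ∀ j < m, iteratedDeriv j (deriv (R i)) a = 0) :
    ∀ j < m, iteratedDeriv j (R (i + 1)) a = 0 := by
  have hnhds : Ioi (0 : ℝ) ∈ 𝓝 a := Ioi_mem_nhds ha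
  have hsucc : R (i + 1) =ᶠ[𝓝 a] fun t => (c i t)⁻¹ * deriv (R i) t := by
    filter_upwards [hnhds] with t ht
    rw [(hR.hasDerivAt i t ht).deriv, inv_mul_cancel_left₀ (hR.ne_zero i t ht)]
  have hderiv : ContDiffOn ℝ ∞ (deriv (R i)) (Ioi 0) :=
    ((hR.contDiffOn_factor i).mul (hR.contDiffOn (i + 1))).congr
      fun t ht => (hR.hasDerivAt i t ht).deriv
  have hc : ContDiffAt ℝ ∞ (fun t => (c i t)⁻¹) a :=
    ((hR.contDiffOn_factor i).contDiffAt hnhds).inv (hR.ne_zero i a ha)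
  intro j hj
  rw [hsucc.iteratedDeriv_eq]
  exact iteratedDeriv_mul_eq_zero hc (hderiv.contDiffAt hnhds) h j hj

theorem IsQuasiDerivSeq.eq_zero_of_iteratedDeriv (hR : IsQuasiDerivSeq R c) (ha : 0 < a) {m : ℕ}
    (h : ∀ j < m, iteratedDeriv j (R i) a = 0) : ∀ j < m, R (i + j) a = 0 := by
  induction m generalizing i with
  | zero => simp
  | succ m ih =>
    rintro (_ | j) hj
    · simpa using h 0 hj
    · change R (i + j + 1) a = 0
      rw [add_right_comm]
      refine ih (hR.iteratedDeriv_succ_eq_zero ha fun k hk => ?_) j (by omega)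
      rw [← iteratedDeriv_succ']
      exact h (k + 1) (by omega)

theorem exists_nat_weights {ι : Type*} {F : Finset ι} {z : ι → ℕ∞} {K : ℕ}
    (h : (K : ℕ∞) ≤ ∑ x ∈ F, z x) :
    ∃ m : ι → ℕ, (∀ x, (m x : ℕ∞) ≤ z x) ∧ K ≤ ∑ x ∈ F, m x := by
  have hcoe : ∀ x, (((min (z x) K).toNat : ℕ) : ℕ∞) = min (z x) K := fun x =>
    ENat.natCast_toNat (ne_top_of_le_ne_top (ENat.natCast_ne_top K) (min_le_right _ _))
  refine ⟨fun x => (min (z x) K).toNat, fun x => (hcoe x).le.trans (min_le_left _ _), ?_⟩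
  by_cases hx : ∃ x ∈ F, (K : ℕ∞) ≤ z x
  · obtain ⟨x, hxF, hxK⟩ := hx
    refine le_trans ?_ (Finset.single_le_sum (fun _ _ => Nat.zero_le _) hxF)
    rw [min_eq_right hxK, ENat.toNat_natCast]
  · push Not at hx
    have : ((∑ x ∈ F, (min (z x) K).toNat : ℕ) : ℕ∞) = ∑ x ∈ F, z x := by
      rw [Nat.cast_sum]
      exact Finset.sum_congr rfl fun x hxF => by rw [hcoe, min_eq_left (hx x hxF).le]
    exact_mod_cast this ▸ h

theorem iteratedDeriv_eq_zero_of_lt_zeroMultiplicity {j : ℕ}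
    (h : (j : ℕ∞) < zeroMultiplicity p a) : iteratedDeriv j p a = 0 := by
  obtain ⟨m, hm⟩ := lt_iSup_iff.1 h
  obtain ⟨hzero, hlt⟩ := lt_iSup_iff.1 hm
  exact hzero j (by exact_mod_cast hlt)

open Classical in
theorem exists_isZeroMultiset_of_lt_zeroCount (h : (M : ℕ∞) < zeroCount I p) :
    ∃ (s : Multiset ℝ) (E : Finset ℝ), (∀ a ∈ s, a ∈ interior I) ∧
      IsZeroMultiset (fun j => iteratedDeriv j p) s ∧
      (∀ e ∈ E, e ∈ I \ interior I ∧ p e = 0) ∧ M < s.card + #E := by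
  obtain ⟨F, hF⟩ := lt_iSup_iff.1 h
  obtain ⟨hFI, hlt⟩ := lt_iSup_iff.1 hF
  obtain ⟨m, hm, hMm⟩ := exists_nat_weights (K := M + 1)
    (by exact_mod_cast Order.add_one_le_of_lt hlt)
  have hm_int : ∀ a ∈ interior I, (m a : ℕ∞) ≤ zeroMultiplicity p a := fun a ha => by
    simpa [zeroWeight, ha] using hm a
  have hm_end : ∀ a ∉ interior I, m a ≤ if p a = 0 then 1 else 0 := fun a ha => by
    have := hm a
    rw [zeroWeight, if_neg ha] at this
    split_ifs at this ⊢ <;> exact_mod_cast this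
  have hcount : ∀ a, (∑ x ∈ F with x ∈ interior I, Multiset.replicate (m x) x).count a =
      if a ∈ F ∧ a ∈ interior I then m a else 0 := fun a => by
    simp [Multiset.count_sum', Multiset.count_replicate]
  refine ⟨∑ x ∈ F with x ∈ interior I, Multiset.replicate (m x) x,
    {x ∈ F | x ∉ interior I ∧ p x = 0}, fun a ha => ?_, fun a j hj => ?_, fun e he => ?_, ?_⟩
  · have := (hcount a).symm.trans_gt (Multiset.count_pos.2 ha)
    by_contra hcon
    simp [hcon] at this
  · rw [hcount] at hj
    split_ifs at hj with ha
    · exact iteratedDeriv_eq_zero_of_lt_zeroMultiplicity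
        ((by exact_mod_cast hj : (j : ℕ∞) < m a).trans_le (hm_int a ha.2))
    · exact absurd hj (Nat.not_lt_zero j)
  · simp only [Finset.mem_filter] at he
    exact ⟨⟨hFI he.1, he.2.1⟩, he.2.2⟩
  · calc M < ∑ x ∈ F, m x := hMm
      _ = ∑ x ∈ F with x ∈ interior I, m x + ∑ x ∈ F with x ∉ interior I, m x :=
        (Finset.sum_filter_add_sum_filter_not F _ m).symm
      _ ≤ ∑ x ∈ F with x ∈ interior I, m x +
          ∑ x ∈ F with x ∉ interior I, if p x = 0 then 1 else 0 := by
        gcongr with x hx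
        exact hm_end x (Finset.mem_filter.1 hx).2
      _ = _ := by
        rw [← Finset.card_filter, Finset.filter_filter]
        simp

end Multiplicity

section ZeroCounting

theorem forall_ge_of_left_of_eventually_right {X : Type*} [ConditionallyCompleteLinearOrder X]
    [TopologicalSpace X] [OrderTopology X] [NoMaxOrder X] {P : X → Prop} {a : X}
    (hleft : ∀ b ≥ a, (∀ y ∈ Ico a b, P y) → P b) (hright : ∀ b ≥ a, P b → ∀ᶠ y in 𝓝[>] b, P y) :
    ∀ x ≥ a, P x := by
  by_contra! hcon
  set B := {x | a ≤ x ∧ ¬P x}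
  have hBdd : BddBelow B := ⟨a, fun x hx => hx.1⟩
  have hBne : B.Nonempty := hcon
  have ha : a ≤ sInf B := le_csInf hBne fun x hx => hx.1
  have hbefore : ∀ y ∈ Ico a (sInf B), P y := fun y hy => by
    by_contra hy'
    exact (csInf_le hBdd ⟨hy.1, hy'⟩).not_gt hy.2
  have hat : P (sInf B) := hleft _ ha hbefore
  obtain ⟨u, hu, hafter⟩ := mem_nhdsGT_iff_exists_Ioo_subset.1 (hright _ ha hat)
  refine (le_csInf hBne fun x hx => ?_).not_gt hu
  by_contra! hxu
  rcases (csInf_le hBdd hx).eq_or_lt with h | h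
  · exact hx.2 (h ▸ hat)
  · exact hx.2 (hafter ⟨h, hxu⟩)

variable {X : Type*} [TopologicalSpace X] {F G : X → ℝ → ℝ} {x₀ : X} {t₀ τ : ℝ}

theorem exists_nhds_isolating_zero (hF : Continuous F.uncurry) (hG : Continuous G.uncurry)
    (h : F x₀ t₀ = 0 → G x₀ t₀ ≠ 0) :
    ∃ U ∈ 𝓝 t₀, ∀ᶠ x in 𝓝 x₀, (∀ t ∈ U, F x t ≠ 0) ∨
      F x₀ t₀ = 0 ∧ U.OrdConnected ∧ ∀ t ∈ U, G x t ≠ 0 := by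
  have hmem : ∀ {H : X → ℝ → ℝ}, Continuous H.uncurry → H x₀ t₀ ≠ 0 →
      ∃ U ∈ 𝓝 t₀, U.OrdConnected ∧ ∀ᶠ x in 𝓝 x₀, ∀ t ∈ U, H x t ≠ 0 := fun {H} hH hne => by
    have hev : ∀ᶠ p : X × ℝ in 𝓝 x₀ ×ˢ 𝓝 t₀, H p.1 p.2 ≠ 0 := by
      rw [← nhds_prod_eq]
      exact hH.continuousAt.eventually_ne hne
    obtain ⟨p, hp, q, hq, hpq⟩ := eventually_prod_iff.1 hev
    obtain ⟨ε, hε, hball⟩ := Metric.mem_nhds_iff.1 hq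
    exact ⟨Metric.ball t₀ ε, Metric.ball_mem_nhds t₀ hε, (convex_ball t₀ ε).ordConnected,
      hp.mono fun x hx t ht => hpq hx (hball ht)⟩
  by_cases h0 : F x₀ t₀ = 0
  · obtain ⟨U, hU, hconn, hev⟩ := hmem hG (h h0)
    exact ⟨U, hU, hev.mono fun x hx => Or.inr ⟨h0, hconn, hx⟩⟩
  · obtain ⟨U, hU, -, hev⟩ := hmem hF h0
    exact ⟨U, hU, hev.mono fun x hx => Or.inl hx⟩

/- Each zero of `F x` lies in an isolating neighbourhood of some zero of `F x₀`; two zeros in the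
same neighbourhood would enclose a zero of `G x` there. -/
theorem eventually_card_le_encard_zeros (hF : Continuous F.uncurry) (hG : Continuous G.uncurry)
    (hnear : ∀ᶠ p : X × ℝ in 𝓝 x₀ ×ˢ 𝓝[>] 0, F p.1 p.2 ≠ 0)
    (hsimple : ∀ t ∈ Ioc 0 τ, F x₀ t = 0 → G x₀ t ≠ 0) :
    ∀ᶠ x in 𝓝 x₀, ∀ (ι : Type) (t : ι → ℝ), (∀ k, t k ∈ Ioc 0 τ ∧ F x (t k) = 0) →
      (∀ k l, k ≠ l → ∃ s ∈ uIcc (t k) (t l), G x s = 0) →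
      ENat.card ι ≤ {t ∈ Ioc 0 τ | F x₀ t = 0}.encard := by
  have hlocal : ∀ z ∈ Icc 0 τ, ∃ U ∈ 𝓝 z, ∀ᶠ x in 𝓝 x₀, (∀ t ∈ U, 0 < t → F x t ≠ 0) ∨
      (z ∈ Ioc 0 τ ∧ F x₀ z = 0) ∧ U.OrdConnected ∧ ∀ t ∈ U, G x t ≠ 0 := by
    intro z hz
    rcases hz.1.eq_or_lt with rfl | hz0
    · obtain ⟨p, hp, q, hq, hpq⟩ := eventually_prod_iff.1 hnear
      exact ⟨{t | 0 < t → q t}, eventually_nhdsWithin_iff.1 hq,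
        hp.mono fun x hx => Or.inl fun t ht ht0 => hpq hx (ht ht0)⟩
    · obtain ⟨U, hU, hev⟩ := exists_nhds_isolating_zero hF hG (hsimple z ⟨hz0, hz.2⟩)
      exact ⟨U, hU, hev.mono fun x hx =>
        hx.imp (fun h t ht _ => h t ht) fun h => ⟨⟨⟨hz0, hz.2⟩, h.1⟩, h.2⟩⟩
  choose! U hU hev using hlocal
  obtain ⟨C, hC, hcover⟩ := isCompact_Icc.elim_nhds_subcover U hU
  filter_upwards [(eventually_all_finset C).2 fun z hz => hev z (hC z hz)] with x hx ι t ht hbetween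
  have hcentre : ∀ k, ∃ z, (z ∈ Ioc 0 τ ∧ F x₀ z = 0) ∧ t k ∈ U z ∧ (U z).OrdConnected ∧
      ∀ s ∈ U z, G x s ≠ 0 := fun k => by
    obtain ⟨z, hz, hkz⟩ := mem_iUnion₂.1 (hcover (Ioc_subset_Icc_self (ht k).1))
    rcases hx z hz with h | h
    · exact absurd (ht k).2 (h _ hkz (ht k).1.1)
    · exact ⟨z, h.1, hkz, h.2⟩
  choose z hz hkz hconn hG_ne using hcentre
  refine ENat.card_le_card_of_injective
    (f := fun k => (⟨z k, hz k⟩ : {t | t ∈ Ioc 0 τ ∧ F x₀ t = 0})) fun k l hkl => ?_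
  have hkl : z k = z l := congrArg Subtype.val hkl
  by_contra hne
  obtain ⟨s, hs, hs0⟩ := hbetween k l hne
  exact hG_ne k s ((hconn k).uIcc_subset (hkz k) (hkl ▸ hkz l) hs) hs0

theorem eventually_exists_zero_of_hasDerivAt {F' : ℝ} (hF : Continuous F.uncurry)
    (h0 : F x₀ t₀ = 0) (hF' : HasDerivAt (F x₀) F' t₀) (hne : F' ≠ 0) {U : Set ℝ}
    (hU : U ∈ 𝓝 t₀) : ∀ᶠ x in 𝓝 x₀, ∃ t ∈ U, F x t = 0 := by
  obtain ⟨ε, hε, hball⟩ := Metric.mem_nhds_iff.1 hU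
  have hB : Metric.ball t₀ ε ∈ 𝓝 t₀ := Metric.ball_mem_nhds t₀ hε
  obtain ⟨a, ha, hFa⟩ : ∃ a ∈ Metric.ball t₀ ε, F x₀ a < 0 := by
    by_contra! hcon
    exact hne (IsLocalMin.hasDerivAt_eq_zero
      (mem_of_superset hB fun t ht => by simpa [h0] using hcon t ht) hF')
  obtain ⟨b, hb, hFb⟩ : ∃ b ∈ Metric.ball t₀ ε, 0 < F x₀ b := by
    by_contra! hcon
    exact hne (IsLocalMax.hasDerivAt_eq_zero
      (mem_of_superset hB fun t ht => by simpa [h0] using hcon t ht) hF')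
  have hcont : ∀ t, Continuous fun x => F x t := fun t => by fun_prop
  filter_upwards [(hcont a).continuousAt.eventually_lt_const hFa,
    (hcont b).continuousAt.eventually_const_lt hFb] with x hxa hxb
  obtain ⟨t, ht, ht0⟩ := intermediate_value_uIcc (f := F x) (a := a) (b := b)
    (by fun_prop) (mem_uIcc_of_le hxa.le hxb.le)
  exact ⟨t, hball ((convex_ball t₀ ε).ordConnected.uIcc_subset ha hb ht), ht0⟩

theorem eventually_encard_le_encard_zeros {Y : Type*} {l : Filter Y} {F : Y → ℝ → ℝ} {T V : Set ℝ}
    (hV : IsOpen V) (hT : T.Finite) (hTV : T ⊆ V)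
    (h : ∀ z ∈ T, ∀ U ∈ 𝓝 z, ∀ᶠ x in l, ∃ t ∈ U, F x t = 0) :
    ∀ᶠ x in l, T.encard ≤ {t ∈ V | F x t = 0}.encard := by
  obtain ⟨U, hU, hdisj⟩ := hT.t2_separation
  have hev : ∀ᶠ x in l, ∀ z ∈ T, ∃ t ∈ V ∩ U z, F x t = 0 :=
    (eventually_all_finite hT).2 fun z hz =>
      h z hz _ (inter_mem (hV.mem_nhds (hTV hz)) ((hU z).2.mem_nhds (hU z).1))
  filter_upwards [hev] with x hx
  choose! t ht ht0 using hx
  refine encard_le_encard_of_injOn (f := t) (fun z hz => ⟨(ht z hz).1, ht0 z hz⟩)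
    fun y hy z hz hyz => ?_
  by_contra hne
  exact disjoint_left.1 (hdisj hy hz hne) (ht y hy).2 (hyz ▸ (ht z hz).2)

theorem eventually_le_encard_zeros {V : Set ℝ} (hV : IsOpen V) (hF : Continuous F.uncurry)
    (hderiv : ∀ t ∈ V, F x₀ t = 0 → ∃ F', F' ≠ 0 ∧ HasDerivAt (F x₀) F' t) {N : ℕ}
    (hN : (N : ℕ∞) ≤ {t ∈ V | F x₀ t = 0}.encard) :
    ∀ᶠ x in 𝓝 x₀, (N : ℕ∞) ≤ {t ∈ V | F x t = 0}.encard := by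
  obtain ⟨T, hT, hTN⟩ := exists_subset_encard_eq hN
  rw [← hTN]
  refine eventually_encard_le_encard_zeros hV (finite_of_encard_eq_coe hTN) (fun z hz => (hT hz).1)
    fun z hz U hU => ?_
  obtain ⟨F', hne, hF'⟩ := hderiv z (hT hz).1 (hT hz).2
  exact eventually_exists_zero_of_hasDerivAt hF (hT hz).2 hF' hne hU

end ZeroCounting

section SturmCounting

/-- A continuous family `F` of functions with simple zeros on `(0, ∞)`, separated by the zeros of
the companion family `G`, which do not enter at `t = 0`. The zero counts of `F x` are controlled
as the parameter `x` varies. -/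
structure HasSeparatedZeros (F G : ℝ → ℝ → ℝ) : Prop where
  continuous : Continuous F.uncurry
  continuous_companion : Continuous G.uncurry
  ne_zero_near_zero : ∀ x₀, ∀ᶠ p : ℝ × ℝ in 𝓝 x₀ ×ˢ 𝓝[>] 0, F p.1 p.2 ≠ 0
  companion_ne_zero : ∀ x t, 0 < t → F x t = 0 → G x t ≠ 0
  companion_between : ∀ x a b, 0 < a → a < b → F x a = 0 → F x b = 0 → ∃ s ∈ Icc a b, G x s = 0
  exists_hasDerivAt : ∀ x t, 0 < t → F x t = 0 → ∃ F', F' ≠ 0 ∧ HasDerivAt (F x) F' t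

variable {F G : ℝ → ℝ → ℝ} {τ x : ℝ}

namespace HasSeparatedZeros

theorem eventually_encard_zeros_le (h : HasSeparatedZeros F G) (x₀ τ : ℝ) :
    ∀ᶠ x in 𝓝 x₀, {t ∈ Ioc 0 τ | F x t = 0}.encard ≤ {t ∈ Ioc 0 τ | F x₀ t = 0}.encard := by
  filter_upwards [eventually_card_le_encard_zeros h.continuous h.continuous_companion
    (h.ne_zero_near_zero x₀) fun t ht => h.companion_ne_zero x₀ t ht.1] with x hx
  refine hx {t | t ∈ Ioc 0 τ ∧ F x t = 0} Subtype.val Subtype.property fun k l hkl => ?_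
  rcases (Subtype.val_injective.ne hkl).lt_or_gt with hlt | hlt
  · rw [uIcc_of_lt hlt]
    exact h.companion_between x _ _ k.2.1.1 hlt k.2.2 l.2.2
  · rw [uIcc_of_gt hlt]
    exact h.companion_between x _ _ l.2.1.1 hlt l.2.2 k.2.2

theorem encard_zeros_le_of_forall_lt (h : HasSeparatedZeros F G) (hx : 0 < x)
    (hlt : ∀ y ∈ Ico 0 x, {t ∈ Ioc 0 τ | F y t = 0}.encard ≤ {z ∈ Ioc 0 y | F z τ = 0}.encard) :
    {t ∈ Ioc 0 τ | F x t = 0}.encard ≤ {z ∈ Ioc 0 x | F z τ = 0}.encard := by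
  have hinterior : ∀ N : ℕ, N ≤ {t ∈ Ioo 0 τ | F x t = 0}.encard →
      ∃ y ∈ Ico 0 x, N ≤ {z ∈ Ioc 0 y | F z τ = 0}.encard := fun N hN => by
    have hev := eventually_le_encard_zeros isOpen_Ioo h.continuous
      (fun t ht => h.exists_hasDerivAt x t ht.1) hN
    obtain ⟨y, hy, hyx⟩ := ((hev.filter_mono nhdsWithin_le_nhds).and
      (Ico_mem_nhdsLT hx)).exists
    refine ⟨y, hyx, (hy.trans (encard_le_encard ?_)).trans (hlt y hyx)⟩
    exact fun t ht => ⟨Ioo_subset_Ioc_self ht.1, ht.2⟩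
  refine ENat.forall_natCast_le_iff_le.1 fun N hN => ?_
  by_cases hτ : 0 < τ ∧ F x τ = 0
  · have hzeros : {t ∈ Ioc 0 τ | F x t = 0} = insert τ {t ∈ Ioo 0 τ | F x t = 0} := by
      ext t
      rcases eq_or_ne t τ with rfl | hne
      · simp [hτ]
      · simp [hne, hne.le_iff_lt]
    rw [hzeros, encard_insert_of_notMem (by simp)] at hN
    rcases N with _ | N
    · exact zero_le
    obtain ⟨y, hy, hNy⟩ := hinterior N
      (ENat.add_le_add_iff_right ENat.one_ne_top |>.1 (by exact_mod_cast hN))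
    calc ((N + 1 : ℕ) : ℕ∞) ≤ {z ∈ Ioc 0 y | F z τ = 0}.encard + 1 := by
          push_cast
          gcongr
      _ = (insert x {z ∈ Ioc 0 y | F z τ = 0}).encard :=
        (encard_insert_of_notMem fun hxy => (hxy.1.2.trans_lt hy.2).false).symm
      _ ≤ {z ∈ Ioc 0 x | F z τ = 0}.encard := encard_le_encard <| insert_subset
        ⟨⟨hx, le_rfl⟩, hτ.2⟩ fun z hz => ⟨⟨hz.1.1, hz.1.2.trans hy.2.le⟩, hz.2⟩
  · have hzeros : {t ∈ Ioc 0 τ | F x t = 0} ⊆ {t ∈ Ioo 0 τ | F x t = 0} := fun t ht =>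
      ⟨⟨ht.1.1, ht.1.2.lt_of_ne fun h => hτ ⟨h ▸ ht.1.1, h ▸ ht.2⟩⟩, ht.2⟩
    obtain ⟨y, hy, hNy⟩ := hinterior N (hN.trans (encard_le_encard hzeros))
    exact hNy.trans (encard_le_encard fun z hz => ⟨⟨hz.1.1, hz.1.2.trans hy.2.le⟩, hz.2⟩)

theorem encard_zeros_le (h : HasSeparatedZeros F G) (h0 : ∀ t, 0 < t → F 0 t ≠ 0) (τ : ℝ) :
    ∀ x ≥ 0, {t ∈ Ioc 0 τ | F x t = 0}.encard ≤ {y ∈ Ioc 0 x | F y τ = 0}.encard := by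
  refine forall_ge_of_left_of_eventually_right (fun x hx hlt => ?_) fun x _ hle => ?_
  · rcases hx.eq_or_lt with rfl | hx
    · rw [encard_eq_zero.2 (eq_empty_of_forall_notMem fun t ht => h0 t ht.1.1 ht.2)]
      exact zero_le
    · exact h.encard_zeros_le_of_forall_lt hx hlt
  · filter_upwards [(h.eventually_encard_zeros_le x τ).filter_mono nhdsWithin_le_nhds,
      self_mem_nhdsWithin] with y hy hxy
    exact (hy.trans hle).trans
      (encard_le_encard fun z hz => ⟨⟨hz.1.1, hz.1.2.trans (le_of_lt hxy)⟩, hz.2⟩)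

end HasSeparatedZeros

end SturmCounting

section Gronwall

variable {E : Type*} [NormedAddCommGroup E] [NormedSpace ℝ E] {f f' : ℝ → E} {T K M η : ℝ}

theorem norm_le_of_norm_deriv_le_mul_exp_sq (hcont : ContinuousOn f (Icc 0 T)) (h0 : f 0 = 0)
    (hderiv : ∀ t ∈ Ico 0 T, HasDerivAt f (f' t) t)
    (hbound : ∀ t ∈ Ico 0 T, ‖f' t‖ ≤ t * (K * (M * Real.exp (K * t ^ 2)) + η)) :
    ∀ t ∈ Icc 0 T, ‖f t‖ ≤ (M * (Real.exp (K * t ^ 2) - 1) + η * t ^ 2) / 2 := by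
  have hbarrier : ∀ t : ℝ, HasDerivAt (fun t => (M * (Real.exp (K * t ^ 2) - 1) + η * t ^ 2) / 2)
      (t * (K * (M * Real.exp (K * t ^ 2)) + η)) t := fun t => by
    have hsq : HasDerivAt (fun t : ℝ => t ^ 2) (2 * t) t := by simpa using hasDerivAt_pow 2 t
    refine ((((hsq.const_mul K).exp.sub_const 1).const_mul M).add (hsq.const_mul η) |>.div_const
      2).congr_deriv ?_
    ring
  exact image_norm_le_of_norm_deriv_right_le_deriv_boundary hcont
    (fun t ht => (hderiv t ht).hasDerivWithinAt) (by simp [h0]) hbarrier hbound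

/- Gronwall's argument with the weight `exp (-K t²)`: let `M` be the maximum of the weighted norm
and compare the estimate at the maximum with `M` itself. -/
theorem norm_le_of_norm_deriv_le_sup (hK : 0 ≤ K) (hη : 0 ≤ η) (hcont : ContinuousOn f (Icc 0 T))
    (h0 : f 0 = 0) (hderiv : ∀ t ∈ Ico 0 T, HasDerivAt f (f' t) t)
    (hbound : ∀ t ∈ Ico 0 T, ∀ B, (∀ s ∈ Icc 0 t, ‖f s‖ ≤ B) → ‖f' t‖ ≤ t * (K * B + η)) :
    ∀ t ∈ Icc 0 T, ‖f t‖ ≤ η * T ^ 2 * Real.exp (K * T ^ 2) := by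
  intro t ht
  obtain ⟨u, hu, hmax⟩ := (isCompact_Icc (a := (0 : ℝ)) (b := T)).exists_isMaxOn
    ⟨t, ht⟩ (f := fun t => ‖f t‖ * Real.exp (-(K * t ^ 2))) (by fun_prop)
  set M := ‖f u‖ * Real.exp (-(K * u ^ 2)) with hM
  have hM0 : 0 ≤ M := by positivity
  have hle_exp : ∀ s ∈ Icc 0 T, ‖f s‖ ≤ M * Real.exp (K * s ^ 2) := fun s hs => by
    rw [← div_le_iff₀ (Real.exp_pos _), div_eq_mul_inv, ← Real.exp_neg]
    exact hmax hs
  have hle := norm_le_of_norm_deriv_le_mul_exp_sq hcont h0 hderiv fun s hs =>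
    hbound s hs _ fun r hr => (hle_exp r ⟨hr.1, hr.2.trans hs.2.le⟩).trans (by
      have := pow_le_pow_left₀ hr.1 hr.2 2
      gcongr)
  have hM_le : M ≤ η * T ^ 2 := by
    have hu_eq : ‖f u‖ = M * Real.exp (K * u ^ 2) := by
      rw [hM, mul_assoc, ← Real.exp_add, neg_add_cancel, Real.exp_zero, mul_one]
    have hone : M * 1 ≤ M * Real.exp (K * u ^ 2) :=
      mul_le_mul_of_nonneg_left (Real.one_le_exp (by positivity)) hM0
    have hsq : η * u ^ 2 ≤ η * T ^ 2 :=
      mul_le_mul_of_nonneg_left (pow_le_pow_left₀ hu.1 hu.2 2) hη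
    linarith [hle u hu]
  have hsq : t ^ 2 ≤ T ^ 2 := pow_le_pow_left₀ ht.1 ht.2 2
  calc ‖f t‖ ≤ M * Real.exp (K * t ^ 2) := hle_exp t ht
    _ ≤ η * T ^ 2 * Real.exp (K * T ^ 2) := by gcongr

end Gronwall

section Even

variable {f : ℝ → ℝ}

theorem apply_abs_of_even (hf : Function.Even f) (t : ℝ) : f |t| = f t := by
  rcases abs_choice t with e | e <;> rw [e]
  exact hf t

theorem continuous_of_even (hf : Function.Even f) (hc : ContinuousOn f (Ici 0)) : Continuous f :=
  (hc.comp_continuous continuous_abs abs_nonneg).congr (apply_abs_of_even hf)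

end Even

/-- The integrated flux `∫₀ᵗ w ψ_x` of the solution with parameter `x`. Since
`(w ψ_x')' = -x² w ψ_x`, it equals `-x⁻² w ψ_x'` for `x ≠ 0`; unlike `w ψ_x'` it does not vanish
identically for `x = 0`. -/
noncomputable def flux (w : ℝ → ℝ) (ψ : ℝ → ℝ → ℝ) (x t : ℝ) : ℝ :=
  ∫ s in (0 : ℝ)..t, w s * ψ x s

/-- `ψ_x` is the even solution of the Sturm–Liouville problem `(w ψ')' = -x² w ψ`, `ψ(0) = 1`,
`ψ'(0) = 0`, stated in the integrated form `w ψ' = -x² ∫₀ᵗ w ψ`, for an increasing weight `w`. -/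
structure IsSturmLiouvilleFamily (w : ℝ → ℝ) (ψ : ℝ → ℝ → ℝ) : Prop where
  continuous_weight : Continuous w
  weight_pos : ∀ t, 0 < t → 0 < w t
  monotoneOn_weight : MonotoneOn w (Ici 0)
  contDiffOn_weight : ContDiffOn ℝ ∞ w (Ioi 0)
  even : ∀ x t, ψ x (-t) = ψ x t
  apply_zero : ∀ x, ψ x 0 = 1
  hasDerivAt : ∀ x t, 0 ≤ t → HasDerivAt (ψ x) (-(x ^ 2 * (flux w ψ x t / w t))) t

variable {w : ℝ → ℝ} {ψ : ℝ → ℝ → ℝ} {x y t τ : ℝ}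

theorem flux_zero_right (x : ℝ) : flux w ψ x 0 = 0 :=
  intervalIntegral.integral_same

namespace IsSturmLiouvilleFamily

section Regularity

theorem apply_abs (h : IsSturmLiouvilleFamily w ψ) (x t : ℝ) : ψ x |t| = ψ x t :=
  apply_abs_of_even (h.even x) t

theorem continuous (h : IsSturmLiouvilleFamily w ψ) (x : ℝ) : Continuous (ψ x) :=
  continuous_of_even (h.even x) fun t ht => (h.hasDerivAt x t ht).continuousAt.continuousWithinAt

theorem continuous_weight_mul (h : IsSturmLiouvilleFamily w ψ) (x : ℝ) :
    Continuous fun t => w t * ψ x t :=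
  h.continuous_weight.mul (h.continuous x)

theorem hasDerivAt_flux (h : IsSturmLiouvilleFamily w ψ) (x t : ℝ) :
    HasDerivAt (flux w ψ x) (w t * ψ x t) t :=
  ((h.continuous_weight_mul x).integral_hasStrictDerivAt 0 t).hasDerivAt

theorem continuous_flux (h : IsSturmLiouvilleFamily w ψ) (x : ℝ) : Continuous (flux w ψ x) :=
  continuous_iff_continuousAt.2 fun t => (h.hasDerivAt_flux x t).continuousAt

theorem apply_param_zero (h : IsSturmLiouvilleFamily w ψ) (t : ℝ) : ψ 0 t = 1 := by
  rw [← h.apply_abs, ← h.apply_zero 0]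
  refine constant_of_has_deriv_right_zero (h.continuous 0).continuousOn (fun s hs => ?_) |t|
    ⟨abs_nonneg t, le_rfl⟩
  simpa using (h.hasDerivAt 0 s hs.1).hasDerivWithinAt

theorem abs_sq_mul_flux_sub_le (h : IsSturmLiouvilleFamily w ψ) {B C : ℝ} (ht : 0 ≤ t)
    (hB : ∀ s ∈ Icc 0 t, |ψ x s - ψ y s| ≤ B) (hC : ∀ s ∈ Icc 0 t, |ψ y s| ≤ C) :
    |x ^ 2 * flux w ψ x t - y ^ 2 * flux w ψ y t| ≤
      w t * (x ^ 2 * B + |x ^ 2 - y ^ 2| * C) * t := by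
  have hint : x ^ 2 * flux w ψ x t - y ^ 2 * flux w ψ y t =
      ∫ s in (0 : ℝ)..t, w s * (x ^ 2 * (ψ x s - ψ y s) + (x ^ 2 - y ^ 2) * ψ y s) := by
    rw [flux, flux, ← intervalIntegral.integral_const_mul, ← intervalIntegral.integral_const_mul,
      ← intervalIntegral.integral_sub
        (((h.continuous_weight_mul x).const_mul _).intervalIntegrable _ _)
        (((h.continuous_weight_mul y).const_mul _).intervalIntegrable _ _)]
    exact intervalIntegral.integral_congr fun s _ => by ring
  have hbound : ∀ s ∈ uIoc 0 t, ‖w s * (x ^ 2 * (ψ x s - ψ y s) + (x ^ 2 - y ^ 2) * ψ y s)‖ ≤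
      w t * (x ^ 2 * B + |x ^ 2 - y ^ 2| * C) := fun s hs => by
    rw [uIoc_of_le ht] at hs
    have hs' : s ∈ Icc 0 t := Ioc_subset_Icc_self hs
    rw [Real.norm_eq_abs, abs_mul, abs_of_pos (h.weight_pos s hs.1)]
    refine mul_le_mul (h.monotoneOn_weight hs.1.le ht hs.2) ((abs_add_le _ _).trans ?_)
      (abs_nonneg _) (h.weight_pos t (hs.1.trans_le hs.2)).le
    rw [abs_mul, abs_mul, abs_of_nonneg (sq_nonneg x)]
    gcongr
    exacts [hB s hs', hC s hs']
  simpa only [hint, sub_zero, abs_of_nonneg ht, Real.norm_eq_abs] using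
    intervalIntegral.norm_integral_le_of_norm_le_const hbound

theorem abs_sub_le (h : IsSturmLiouvilleFamily w ψ) {T C : ℝ}
    (hC : ∀ s ∈ Icc 0 T, |ψ y s| ≤ C) : ∀ t ∈ Icc 0 T,
    |ψ x t - ψ y t| ≤ |x ^ 2 - y ^ 2| * C * T ^ 2 * Real.exp (x ^ 2 * T ^ 2) := by
  intro t₀ ht₀
  have hC0 : 0 ≤ C := (abs_nonneg _).trans (hC t₀ ht₀)
  refine norm_le_of_norm_deriv_le_sup (f := fun t => ψ x t - ψ y t) (sq_nonneg x) (by positivity)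
    ((h.continuous x).sub (h.continuous y)).continuousOn (by simp [h.apply_zero])
    (fun t ht => (h.hasDerivAt x t ht.1).sub (h.hasDerivAt y t ht.1)) (fun t ht B hB => ?_) t₀ ht₀
  rcases ht.1.eq_or_lt with rfl | ht0
  · simp [flux_zero_right]
  have hw := h.weight_pos t ht0
  have heq : -(x ^ 2 * (flux w ψ x t / w t)) - -(y ^ 2 * (flux w ψ y t / w t)) =
      -((x ^ 2 * flux w ψ x t - y ^ 2 * flux w ψ y t) / w t) := by ring
  rw [heq, norm_neg, Real.norm_eq_abs, abs_div, abs_of_pos hw, div_le_iff₀ hw]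
  refine (h.abs_sq_mul_flux_sub_le ht.1 hB fun s hs => hC s ⟨hs.1, hs.2.trans ht.2.le⟩).trans_eq ?_
  ring

theorem continuous_uncurry (h : IsSturmLiouvilleFamily w ψ) : Continuous ψ.uncurry := by
  rw [continuous_iff_continuousAt]
  rintro ⟨y, t₀⟩
  set T := |t₀| + 1 with hT
  obtain ⟨C, hC⟩ := (isCompact_Icc (a := (0 : ℝ)) (b := T)).exists_bound_of_continuousOn
    (h.continuous y).continuousOn
  have hbound : Tendsto (fun p : ℝ × ℝ => |p.1 ^ 2 - y ^ 2| * C * T ^ 2 *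
      Real.exp (p.1 ^ 2 * T ^ 2)) (𝓝 (y, t₀)) (𝓝 0) :=
    Continuous.tendsto' (by fun_prop) _ _ (by simp)
  have hdiff : Tendsto (fun p : ℝ × ℝ => ψ p.1 p.2 - ψ y p.2) (𝓝 (y, t₀)) (𝓝 0) := by
    refine squeeze_zero_norm' ?_ hbound
    have hev : ∀ᶠ p : ℝ × ℝ in 𝓝 (y, t₀), |p.2| < T :=
      (continuous_abs.comp continuous_snd).continuousAt.eventually_lt_const (by simp [hT])
    filter_upwards [hev] with p hp
    rw [Real.norm_eq_abs, ← h.apply_abs p.1, ← h.apply_abs y]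
    exact h.abs_sub_le hC _ ⟨abs_nonneg _, hp.le⟩
  have hy : Tendsto (fun p : ℝ × ℝ => ψ y p.2) (𝓝 (y, t₀)) (𝓝 (ψ y t₀)) :=
    ((h.continuous y).comp continuous_snd).tendsto (y, t₀)
  simpa [ContinuousAt, Function.uncurry_def] using hdiff.add hy

theorem continuous_uncurry_flux (h : IsSturmLiouvilleFamily w ψ) :
    Continuous (flux w ψ).uncurry := by
  have hψ := h.continuous_uncurry
  have hw := h.continuous_weight
  have hint : Continuous (Function.uncurry fun (p : ℝ × ℝ) s => w s * ψ p.1 s) := by fun_prop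
  exact intervalIntegral.continuous_parametric_intervalIntegral_of_continuous (a₀ := 0) hint
    continuous_snd

end Regularity

section Zeros

theorem eventually_pos (h : IsSturmLiouvilleFamily w ψ) (x : ℝ) :
    ∀ᶠ p : ℝ × ℝ in 𝓝 x ×ˢ 𝓝 0, 0 < ψ p.1 p.2 := by
  rw [← nhds_prod_eq]
  exact h.continuous_uncurry.continuousAt.eventually_const_lt (by simp [h.apply_zero])

theorem flux_pos (h : IsSturmLiouvilleFamily w ψ) (ht : 0 < t) (hψ : ∀ s ∈ Ioo 0 t, 0 < ψ x s) :
    0 < flux w ψ x t :=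
  intervalIntegral.intervalIntegral_pos_of_pos_on
    ((h.continuous_weight_mul x).intervalIntegrable _ _)
    (fun s hs => mul_pos (h.weight_pos s hs.1) (hψ s hs)) ht

theorem eventually_flux_pos (h : IsSturmLiouvilleFamily w ψ) (x : ℝ) :
    ∀ᶠ p : ℝ × ℝ in 𝓝 x ×ˢ 𝓝[>] 0, 0 < flux w ψ p.1 p.2 := by
  obtain ⟨p, hp, q, hq, hpq⟩ := eventually_prod_iff.1 (h.eventually_pos x)
  obtain ⟨ε, hε, hball⟩ := Metric.eventually_nhds_iff.1 hq
  refine eventually_prod_iff.2 ⟨p, hp, fun t => t ∈ Ioo 0 ε, Ioo_mem_nhdsGT hε,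
    fun hy t ht => h.flux_pos ht.1 fun s hs => hpq (y := s) hy (hball ?_)⟩
  rw [Real.dist_eq, sub_zero, abs_of_pos hs.1]
  exact hs.2.trans ht.2

theorem lipschitzWith_system (h : IsSturmLiouvilleFamily w ψ) (x : ℝ) {ε s : ℝ} (hε : 0 < ε)
    (hs : s ∈ Ioc ε t) : LipschitzWith (Real.toNNReal (x ^ 2 / w ε + w t))
      fun p : ℝ × ℝ => (-(x ^ 2 * (p.2 / w s)), w s * p.1) := by
  have hwε := h.weight_pos ε hε
  have hs0 := hε.trans hs.1
  have hws := h.weight_pos s hs0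
  have hwt := h.weight_pos t (hs0.trans_le hs.2)
  have hεs := h.monotoneOn_weight hε.le hs0.le hs.1.le
  have hst := h.monotoneOn_weight hs0.le (hs0.le.trans hs.2) hs.2
  refine LipschitzWith.of_dist_le_mul fun p q => ?_
  rw [Real.coe_toNNReal _ (by positivity), Prod.dist_eq, Prod.dist_eq]
  refine max_le ?_ ?_
  · calc dist (-(x ^ 2 * (p.2 / w s))) (-(x ^ 2 * (q.2 / w s)))
        = x ^ 2 / w s * dist p.2 q.2 := by
          rw [dist_neg_neg, Real.dist_eq, Real.dist_eq, ← mul_sub, ← sub_div, abs_mul, abs_div,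
            abs_of_pos hws, abs_of_nonneg (sq_nonneg x)]
          ring
      _ ≤ (x ^ 2 / w ε + w t) * max (dist p.1 q.1) (dist p.2 q.2) := by
          gcongr
          · exact le_add_of_le_of_nonneg (by gcongr) hwt.le
          · exact le_max_right _ _
  · calc dist (w s * p.1) (w s * q.1) = w s * dist p.1 q.1 := by
          rw [Real.dist_eq, Real.dist_eq, ← mul_sub, abs_mul, abs_of_pos hws]
      _ ≤ (x ^ 2 / w ε + w t) * max (dist p.1 q.1) (dist p.2 q.2) := by
          gcongr
          · exact le_add_of_nonneg_of_le (by positivity) hst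
          · exact le_max_left _ _

/- The pair `(ψ_x, ∫₀ᵗ w ψ_x)` solves a linear first order system, regular away from `0`. -/
theorem eq_zero_of_flux_eq_zero (h : IsSturmLiouvilleFamily w ψ) {ε : ℝ} (hε : 0 < ε)
    (hψ : ψ x t = 0) (hflux : flux w ψ x t = 0) (hεt : ε ≤ t) : ψ x ε = 0 := by
  have heq := ODE_solution_unique_of_mem_Icc_left (f := fun s => (ψ x s, flux w ψ x s))
    (g := fun _ => (0, 0)) (b := t)
    (fun s hs => (h.lipschitzWith_system x hε hs).lipschitzOnWith (s := univ))
    ((h.continuous x).prodMk (h.continuous_flux x)).continuousOn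
    (fun s hs => ((h.hasDerivAt x s (hε.trans hs.1).le).prodMk
      (h.hasDerivAt_flux x s)).hasDerivWithinAt)
    (fun s _ => mem_univ _) continuousOn_const
    (fun s _ => (hasDerivWithinAt_const s (Iic s) ((0 : ℝ), (0 : ℝ))).congr_deriv
      (Prod.ext (by simp) (by simp)))
    (fun s _ => mem_univ _) (by simp [hψ, hflux])
  exact congrArg Prod.fst (heq ⟨le_rfl, hεt⟩)

theorem flux_ne_zero (h : IsSturmLiouvilleFamily w ψ) (ht : 0 < t) (hψ : ψ x t = 0) :
    flux w ψ x t ≠ 0 := by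
  intro hflux
  have hpos : ∀ᶠ ε in 𝓝[>] 0, 0 < ψ x ε :=
    ((h.continuous x).continuousAt.eventually_const_lt (by simp [h.apply_zero])).filter_mono
      nhdsWithin_le_nhds
  obtain ⟨ε, hψε, hε⟩ := (hpos.and (Ioo_mem_nhdsGT ht)).exists
  exact hψε.ne' (h.eq_zero_of_flux_eq_zero hε.1 hψ hflux hε.2.le)

theorem exists_flux_zero_between (h : IsSturmLiouvilleFamily w ψ) {a b : ℝ} (ha : 0 ≤ a)
    (hab : a < b) (hψa : ψ x a = 0) (hψb : ψ x b = 0) : ∃ s ∈ Ioo a b, flux w ψ x s = 0 := by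
  have hx : x ≠ 0 := fun hx => by simp [hx, h.apply_param_zero] at hψa
  obtain ⟨s, hs, hs0⟩ := exists_hasDerivAt_eq_zero hab (h.continuous x).continuousOn
    (hψa.trans hψb.symm) fun s hs => h.hasDerivAt x s (ha.trans hs.1.le)
  exact ⟨s, hs, by simpa [hx, (h.weight_pos s (ha.trans_lt hs.1)).ne'] using hs0⟩

theorem hasSeparatedZeros_psi (h : IsSturmLiouvilleFamily w ψ) :
    HasSeparatedZeros ψ (flux w ψ) where
  continuous := h.continuous_uncurry
  continuous_companion := h.continuous_uncurry_flux
  ne_zero_near_zero x := ((h.eventually_pos x).filter_mono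
    (Filter.prod_mono le_rfl nhdsWithin_le_nhds)).mono fun _ hp => hp.ne'
  companion_ne_zero _ _ ht := h.flux_ne_zero ht
  companion_between _ _ _ ha hab hψa hψb :=
    (h.exists_flux_zero_between ha.le hab hψa hψb).imp fun _ hs => ⟨Ioo_subset_Icc_self hs.1, hs.2⟩
  exists_hasDerivAt x t ht hψ := by
    have hx : x ≠ 0 := fun hx => by simp [hx, h.apply_param_zero] at hψ
    exact ⟨_, by simp [hx, h.flux_ne_zero ht hψ, (h.weight_pos t ht).ne'], h.hasDerivAt x t ht.le⟩

theorem hasSeparatedZeros_flux (h : IsSturmLiouvilleFamily w ψ) :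
    HasSeparatedZeros (flux w ψ) ψ where
  continuous := h.continuous_uncurry_flux
  continuous_companion := h.continuous_uncurry
  ne_zero_near_zero x := (h.eventually_flux_pos x).mono fun _ hp => hp.ne'
  companion_ne_zero _ _ ht hflux hψ := h.flux_ne_zero ht hψ hflux
  companion_between x a b ha hab hfa hfb := by
    obtain ⟨s, hs, hs0⟩ := exists_hasDerivAt_eq_zero hab
      (h.continuous_flux x).continuousOn (hfa.trans hfb.symm)
      fun s _ => h.hasDerivAt_flux x s
    exact ⟨s, Ioo_subset_Icc_self hs,
      (mul_eq_zero.1 hs0).resolve_left (h.weight_pos s (ha.trans hs.1)).ne'⟩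
  exists_hasDerivAt x t ht hflux :=
    ⟨_, mul_ne_zero (h.weight_pos t ht).ne' fun hψ => h.flux_ne_zero ht hψ hflux,
      h.hasDerivAt_flux x t⟩

theorem encard_psi_zeros_le (h : IsSturmLiouvilleFamily w ψ) (hx : 0 ≤ x) :
    {t ∈ Ioc 0 τ | ψ x t = 0}.encard ≤ {y ∈ Ioc 0 x | ψ y τ = 0}.encard :=
  h.hasSeparatedZeros_psi.encard_zeros_le (fun t _ => by simp [h.apply_param_zero]) τ x hx

theorem encard_flux_zeros_le (h : IsSturmLiouvilleFamily w ψ) (hx : 0 ≤ x) :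
    {t ∈ Ioc 0 τ | flux w ψ x t = 0}.encard ≤ {y ∈ Ioc 0 x | flux w ψ y τ = 0}.encard :=
  h.hasSeparatedZeros_flux.encard_zeros_le
    (fun t ht => (h.flux_pos ht fun s _ => by simp [h.apply_param_zero]).ne') τ x hx

theorem encard_psi_zeros_le_encard_flux_zeros_add_one (h : IsSturmLiouvilleFamily w ψ) (x τ : ℝ) :
    {t ∈ Ioc 0 τ | ψ x t = 0}.encard ≤ {t ∈ Ioo 0 τ | flux w ψ x t = 0}.encard + 1 := by
  refine ENat.forall_natCast_le_iff_le.1 fun N hN => ?_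
  obtain ⟨T, hT, hTN⟩ := exists_subset_encard_eq hN
  lift T to Finset ℝ using finite_of_encard_eq_coe hTN
  obtain ⟨G, hcard, -, hG⟩ := exists_finset_interlacing T fun a ha b hb hab =>
    h.exists_flux_zero_between (hT ha).1.1.le hab (hT ha).2 (hT hb).2
  rw [← hTN, encard_coe_eq_coe_finsetCard]
  refine (by exact_mod_cast hcard : ((#T : ℕ) : ℕ∞) ≤ #G + 1).trans ?_
  rw [← encard_coe_eq_coe_finsetCard]
  gcongr
  intro s hs
  obtain ⟨hs0, a, ha, b, hb, hsab⟩ := hG s hs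
  exact ⟨⟨(hT ha).1.1.trans hsab.1, hsab.2.trans_le (hT hb).1.2⟩, hs0⟩

end Zeros

end IsSturmLiouvilleFamily

section Enumeration

variable {S : Set ℝ}

theorem isLeast_csInf_of_finite_inter_Iic (hfin : ∀ b, (S ∩ Iic b).Finite) {U : Set ℝ}
    (hU : U ⊆ S) (hne : U.Nonempty) : IsLeast U (sInf U) := by
  obtain ⟨b, hb⟩ := hne
  have hUb : (U ∩ Iic b).Finite := (hfin b).subset (inter_subset_inter_left _ hU)
  obtain ⟨a, ha, hmin⟩ := hUb.exists_minimal ⟨b, hb, le_refl b⟩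
  have hleast : IsLeast U a := by
    refine ⟨ha.1, fun y hy => ?_⟩
    by_contra! hlt
    exact absurd (hmin ⟨hy, hlt.le.trans ha.2⟩ hlt.le) (not_le.2 hlt)
  rwa [hleast.csInf_eq]

theorem isLeast_nthSmallest_succ (hfin : ∀ b, (S ∩ Iic b).Finite) (hinf : S.Infinite) (k : ℕ) :
    IsLeast {x | x ∈ S ∧ nthSmallest S k < x} (nthSmallest S (k + 1)) := by
  refine isLeast_csInf_of_finite_inter_Iic hfin (fun x hx => hx.1) ?_
  obtain ⟨x, hx, hx'⟩ := hinf.exists_notMem_finite (hfin (nthSmallest S k))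
  exact ⟨x, hx, not_le.1 fun h => hx' ⟨hx, h⟩⟩

theorem nthSmallest_mem (hfin : ∀ b, (S ∩ Iic b).Finite) (hinf : S.Infinite) (k : ℕ) :
    nthSmallest S k ∈ S := by
  cases k with
  | zero => exact (isLeast_csInf_of_finite_inter_Iic hfin Subset.rfl hinf.nonempty).1
  | succ k => exact (isLeast_nthSmallest_succ hfin hinf k).1.1

theorem nthSmallest_strictMono (hfin : ∀ b, (S ∩ Iic b).Finite) (hinf : S.Infinite) :
    StrictMono (nthSmallest S) :=
  strictMono_nat_of_lt_succ fun k => (isLeast_nthSmallest_succ hfin hinf k).1.2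

theorem encard_inter_Iic_nthSmallest_le (hfin : ∀ b, (S ∩ Iic b).Finite) (hinf : S.Infinite)
    (k : ℕ) : (S ∩ Iic (nthSmallest S k)).encard ≤ k + 1 := by
  induction k with
  | zero =>
    have hleast := isLeast_csInf_of_finite_inter_Iic hfin Subset.rfl hinf.nonempty
    have hsub : S ∩ Iic (nthSmallest S 0) ⊆ {nthSmallest S 0} := fun x hx =>
      le_antisymm hx.2 (hleast.2 hx.1)
    simpa using encard_le_encard hsub
  | succ k ih =>
    have hsub : S ∩ Iic (nthSmallest S (k + 1)) ⊆
        insert (nthSmallest S (k + 1)) (S ∩ Iic (nthSmallest S k)) := by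
      rintro x ⟨hx, hxl⟩
      rcases le_or_gt x (nthSmallest S k) with h | h
      · exact Or.inr ⟨hx, h⟩
      · exact Or.inl (le_antisymm hxl ((isLeast_nthSmallest_succ hfin hinf k).2 ⟨hx, h⟩))
    push_cast
    exact (encard_le_encard hsub).trans ((encard_insert_le _ _).trans (by gcongr))

end Enumeration

namespace IsSturmLiouvilleFamily

variable {w : ℝ → ℝ} {ψ : ℝ → ℝ → ℝ} {x y τ a b : ℝ}

section Finiteness

theorem sub_mul_integral_mul (h : IsSturmLiouvilleFamily w ψ) (x y : ℝ) (hτ : 0 ≤ τ) :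
    (x ^ 2 - y ^ 2) * ∫ s in (0 : ℝ)..τ, w s * (ψ x s * ψ y s) =
      x ^ 2 * flux w ψ x τ * ψ y τ - y ^ 2 * flux w ψ y τ * ψ x τ := by
  have hx := h.continuous x
  have hy := h.continuous y
  have hfx := h.continuous_flux x
  have hfy := h.continuous_flux y
  have hw := h.continuous_weight
  have hderiv : ∀ s ∈ Ioo 0 τ,
      HasDerivAt (fun s => x ^ 2 * flux w ψ x s * ψ y s - y ^ 2 * flux w ψ y s * ψ x s)
        ((x ^ 2 - y ^ 2) * (w s * (ψ x s * ψ y s))) s := fun s hs => by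
    refine ((((h.hasDerivAt_flux x s).const_mul (x ^ 2)).mul (h.hasDerivAt y s hs.1.le)).sub
      (((h.hasDerivAt_flux y s).const_mul (y ^ 2)).mul (h.hasDerivAt x s hs.1.le))).congr_deriv ?_
    ring
  rw [← intervalIntegral.integral_const_mul,
    intervalIntegral.integral_eq_sub_of_hasDerivAt_of_le hτ (by fun_prop) hderiv
      (Continuous.intervalIntegrable (by fun_prop) _ _)]
  simp [flux_zero_right]

theorem eventually_integral_mul_pos (h : IsSturmLiouvilleFamily w ψ) (hτ : 0 < τ) (x : ℝ) :
    ∀ᶠ p : ℝ × ℝ in 𝓝 x ×ˢ 𝓝 x, 0 < ∫ s in (0 : ℝ)..τ, w s * (ψ p.1 s * ψ p.2 s) := by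
  have hψ := h.continuous_uncurry
  have hw := h.continuous_weight
  have hcont : Continuous fun p : ℝ × ℝ => ∫ s in (0 : ℝ)..τ, w s * (ψ p.1 s * ψ p.2 s) := by
    refine intervalIntegral.continuous_parametric_intervalIntegral_of_continuous (a₀ := 0)
      (f := fun (p : ℝ × ℝ) s => w s * (ψ p.1 s * ψ p.2 s)) ?_ continuous_const
    fun_prop
  have hnonneg : ∀ s ∈ Ioc 0 τ, 0 ≤ w s * (ψ x s * ψ x s) := fun s hs =>
    mul_nonneg (h.weight_pos s hs.1).le (mul_self_nonneg _)
  have hpos : ∀ᶠ s in 𝓝[>] 0, 0 < ψ x s :=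
    ((h.continuous x).continuousAt.eventually_const_lt (by simp [h.apply_zero])).filter_mono
      nhdsWithin_le_nhds
  obtain ⟨s, hψs, hs⟩ := (hpos.and (Ioo_mem_nhdsGT hτ)).exists
  rw [← nhds_prod_eq]
  exact hcont.continuousAt.eventually_const_lt (intervalIntegral.integral_pos hτ
    (by fun_prop) hnonneg ⟨s, Ioo_subset_Icc_self hs, mul_pos (h.weight_pos s hs.1)
      (mul_pos hψs hψs)⟩)

theorem finite_inter_Iic_of_orthogonal (h : IsSturmLiouvilleFamily w ψ) (hτ : 0 < τ) {S : Set ℝ}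
    (hS : S ⊆ Ioi 0)
    (horth : S.Pairwise fun x y => ∫ s in (0 : ℝ)..τ, w s * (ψ x s * ψ y s) = 0) (b : ℝ) :
    (S ∩ Iic b).Finite := by
  have hfin : (S ∩ Icc 0 b).Finite := by
    refine (isCompact_Icc (a := (0 : ℝ)) (b := b)).induction_on (p := fun U => (S ∩ U).Finite)
      (by simp) (fun s t hst ht => ht.subset (inter_subset_inter_right _ hst))
      (fun s t hs ht => by rw [inter_union_distrib_left]; exact hs.union ht) (fun x _ => ?_)
    obtain ⟨U, hU, hUpos⟩ := mem_prod_same_iff.1 (h.eventually_integral_mul_pos hτ x)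
    refine ⟨U, mem_nhdsWithin_of_mem_nhds hU, Set.Subsingleton.finite ?_⟩
    rintro a ⟨haS, haU⟩ c ⟨hcS, hcU⟩
    by_contra hne
    exact (show 0 < ∫ s in (0 : ℝ)..τ, w s * (ψ a s * ψ c s) from
      hUpos (mk_mem_prod haU hcU)).ne' (horth haS hcS hne)
  exact hfin.subset fun y hy => ⟨hy.1, (hS hy.1).le, hy.2⟩

theorem integral_mul_eq_zero (h : IsSturmLiouvilleFamily w ψ) (hτ : 0 ≤ τ) (hx : 0 < x)
    (hy : 0 < y) (hxy : x ≠ y)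
    (hbdry : x ^ 2 * flux w ψ x τ * ψ y τ = y ^ 2 * flux w ψ y τ * ψ x τ) :
    ∫ s in (0 : ℝ)..τ, w s * (ψ x s * ψ y s) = 0 := by
  have hmul := h.sub_mul_integral_mul x y hτ
  rw [hbdry, sub_self] at hmul
  exact (mul_eq_zero.1 hmul).resolve_left fun e =>
    hxy ((pow_left_inj₀ hx.le hy.le two_ne_zero).1 (sub_eq_zero.1 e))

theorem finite_psi_zeros (h : IsSturmLiouvilleFamily w ψ) (hτ : 0 < τ) (b : ℝ) :
    ({y | 0 < y ∧ ψ y τ = 0} ∩ Iic b).Finite :=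
  h.finite_inter_Iic_of_orthogonal hτ (fun _ hx => hx.1) (fun x hx y hy hne =>
    h.integral_mul_eq_zero hτ.le hx.1 hy.1 hne (by simp [hx.2, hy.2])) b

theorem finite_flux_zeros (h : IsSturmLiouvilleFamily w ψ) (hτ : 0 < τ) (b : ℝ) :
    ({y | 0 < y ∧ flux w ψ y τ = 0} ∩ Iic b).Finite :=
  h.finite_inter_Iic_of_orthogonal hτ (fun _ hx => hx.1) (fun x hx y hy hne =>
    h.integral_mul_eq_zero hτ.le hx.1 hy.1 hne (by simp [hx.2, hy.2])) b

end Finiteness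

section Infinitude

/- The Prüfer angle of `ψ_x`. -/
theorem hasDerivAt_arctan_flux_div (h : IsSturmLiouvilleFamily w ψ) {s : ℝ} (hs : 0 < s)
    (hψ : ψ x s ≠ 0) : HasDerivAt (fun s => Real.arctan (x * flux w ψ x s / ψ x s))
      (x * ((w s + (x * flux w ψ x s / ψ x s) ^ 2 / w s) /
        (1 + (x * flux w ψ x s / ψ x s) ^ 2))) s := by
  have hws := (h.weight_pos s hs).ne'
  refine (((h.hasDerivAt_flux x s).const_mul x).div (h.hasDerivAt x s hs.le)
    hψ).arctan.congr_deriv ?_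
  simp only [Pi.div_apply]
  field_simp
  ring

theorem min_weight_inv_le (h : IsSturmLiouvilleFamily w ψ) {s : ℝ} (ha : 0 < a)
    (hs : s ∈ Icc a b) (q : ℝ) :
    min (w a) (w b)⁻¹ ≤ (w s + q ^ 2 / w s) / (1 + q ^ 2) := by
  have hs0 : 0 < s := ha.trans_le hs.1
  have hle : min (w a) (w b)⁻¹ ≤ w s :=
    (min_le_left _ _).trans (h.monotoneOn_weight ha.le hs0.le hs.1)
  have hle_inv : min (w a) (w b)⁻¹ ≤ (w s)⁻¹ := (min_le_right _ _).trans
    (inv_anti₀ (h.weight_pos s hs0) (h.monotoneOn_weight hs0.le (hs0.trans_le hs.2).le hs.2))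
  rw [le_div_iff₀ (by positivity), div_eq_mul_inv]
  nlinarith [mul_le_mul_of_nonneg_left hle_inv (sq_nonneg q)]

theorem eventually_exists_zero (h : IsSturmLiouvilleFamily w ψ) (ha : 0 < a) (hab : a < b) :
    ∀ᶠ x in atTop, ∃ t ∈ Icc a b, ψ x t = 0 := by
  set c := min (w a) (w b)⁻¹
  have hc0 : 0 < c := lt_min (h.weight_pos a ha) (inv_pos.2 (h.weight_pos b (ha.trans hab)))
  filter_upwards [eventually_ge_atTop 0, eventually_ge_atTop (Real.pi / (c * (b - a)))]
    with x hx hlarge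
  by_contra! hne
  have hderiv : ∀ s ∈ Icc a b, _ := fun s hs =>
    h.hasDerivAt_arctan_flux_div (ha.trans_le hs.1) (hne s hs)
  obtain ⟨s, hs, hslope⟩ := exists_hasDerivAt_eq_slope _ _ hab
    (fun s hs => (hderiv s hs).continuousAt.continuousWithinAt)
    (fun s hs => hderiv s (Ioo_subset_Icc_self hs))
  have hge := mul_le_mul_of_nonneg_left
    (h.min_weight_inv_le ha (Ioo_subset_Icc_self hs) (x * flux w ψ x s / ψ x s)) hx
  rw [hslope, le_div_iff₀ (sub_pos.2 hab)] at hge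
  rw [div_le_iff₀ (mul_pos hc0 (sub_pos.2 hab))] at hlarge
  have hlt := Real.arctan_lt_pi_div_two (x * flux w ψ x b / ψ x b)
  have hgt := Real.neg_pi_div_two_lt_arctan (x * flux w ψ x a / ψ x a)
  linarith

theorem eventually_le_encard_psi_zeros (h : IsSturmLiouvilleFamily w ψ) (hτ : 0 < τ) (N : ℕ) :
    ∀ᶠ x in atTop, (N : ℕ∞) ≤ {t ∈ Ioo 0 τ | ψ x t = 0}.encard := by
  obtain ⟨T, hTsub, hTN⟩ := (Ioo_infinite hτ).exists_subset_card_eq N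
  rw [← hTN, ← encard_coe_eq_coe_finsetCard]
  refine eventually_encard_le_encard_zeros isOpen_Ioo T.finite_toSet hTsub fun z hz U hU => ?_
  obtain ⟨b, hzb, hbU⟩ := exists_Ico_subset_of_mem_nhds hU (exists_gt z)
  obtain ⟨c, hzc, hcb⟩ := exists_between hzb
  exact (h.eventually_exists_zero (hTsub hz).1 hzc).mono fun x ⟨t, ht, ht0⟩ =>
    ⟨t, hbU ⟨ht.1, ht.2.trans_lt hcb⟩, ht0⟩

theorem infinite_psi_zeros (h : IsSturmLiouvilleFamily w ψ) (hτ : 0 < τ) :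
    {y | 0 < y ∧ ψ y τ = 0}.Infinite := by
  refine encard_eq_top_iff.1 (ENat.eq_top_iff_forall_ge.2 fun N => ?_)
  obtain ⟨x, hN, hx⟩ := ((h.eventually_le_encard_psi_zeros hτ N).and (eventually_ge_atTop 0)).exists
  calc (N : ℕ∞) ≤ {t ∈ Ioc 0 τ | ψ x t = 0}.encard :=
        hN.trans (encard_le_encard fun t ht => ⟨Ioo_subset_Ioc_self ht.1, ht.2⟩)
    _ ≤ {y ∈ Ioc 0 x | ψ y τ = 0}.encard := h.encard_psi_zeros_le hx
    _ ≤ {y | 0 < y ∧ ψ y τ = 0}.encard := encard_le_encard fun y hy => ⟨hy.1.1, hy.2⟩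

theorem infinite_flux_zeros (h : IsSturmLiouvilleFamily w ψ) (hτ : 0 < τ) :
    {y | 0 < y ∧ flux w ψ y τ = 0}.Infinite := by
  refine encard_eq_top_iff.1 (ENat.eq_top_iff_forall_ge.2 fun N => ?_)
  obtain ⟨x, hN, hx⟩ :=
    ((h.eventually_le_encard_psi_zeros hτ (N + 1)).and (eventually_ge_atTop 0)).exists
  have hψ : ((N + 1 : ℕ) : ℕ∞) ≤ {t ∈ Ioc 0 τ | ψ x t = 0}.encard :=
    hN.trans (encard_le_encard fun t ht => ⟨Ioo_subset_Ioc_self ht.1, ht.2⟩)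
  have hflux : (N : ℕ∞) ≤ {t ∈ Ioo 0 τ | flux w ψ x t = 0}.encard := by
    have := hψ.trans (h.encard_psi_zeros_le_encard_flux_zeros_add_one x τ)
    push_cast at this
    exact (ENat.add_le_add_iff_right ENat.one_ne_top).1 this
  calc (N : ℕ∞) ≤ {t ∈ Ioc 0 τ | flux w ψ x t = 0}.encard :=
        hflux.trans (encard_le_encard fun t ht => ⟨Ioo_subset_Ioc_self ht.1, ht.2⟩)
    _ ≤ {y ∈ Ioc 0 x | flux w ψ y τ = 0}.encard := h.encard_flux_zeros_le hx
    _ ≤ {y | 0 < y ∧ flux w ψ y τ = 0}.encard := encard_le_encard fun y hy => ⟨hy.1.1, hy.2⟩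

end Infinitude

end IsSturmLiouvilleFamily

section Modes

/-- The quasi-derivatives of `ψ_x`: alternately apply `w ∂ₜ` and `w⁻¹ ∂ₜ`, so that
`w⁻¹ ∂ₜ w ∂ₜ ψ_x = -x² ψ_x` gives the recursion. -/
noncomputable def quasiDeriv (w : ℝ → ℝ) (ψ : ℝ → ℝ → ℝ) (x : ℝ) : ℕ → ℝ → ℝ
  | 0, t => ψ x t
  | 1, t => -x ^ 2 * flux w ψ x t
  | i + 2, t => -x ^ 2 * quasiDeriv w ψ x i t

/-- The quasi-derivatives of the linear combination `∑ k < n, a k * ψ_{x k}`. The constant function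
is the mode with parameter `0`. -/
noncomputable def modeSum (w : ℝ → ℝ) (ψ : ℝ → ℝ → ℝ) (x : ℕ → ℝ) (n : ℕ) (a : ℕ → ℝ) (i : ℕ)
    (t : ℝ) : ℝ :=
  ∑ k ∈ Finset.range n, a k * quasiDeriv w ψ (x k) i t

variable {w : ℝ → ℝ} {ψ : ℝ → ℝ → ℝ} {τ : ℝ} {x a : ℕ → ℝ} {i n q N : ℕ}

theorem quasiDeriv_two_mul_add (x : ℝ) (j i : ℕ) (t : ℝ) :
    quasiDeriv w ψ x (2 * j + i) t = (-x ^ 2) ^ j * quasiDeriv w ψ x i t := by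
  induction j with
  | zero => simp
  | succ j ih =>
    rw [show 2 * (j + 1) + i = 2 * j + i + 2 by ring, quasiDeriv, ih, pow_succ]
    ring

theorem modeSum_eq_zero {t : ℝ} (h : ∀ k, quasiDeriv w ψ (x k) i t = 0) (j : ℕ) :
    modeSum w ψ x n a (2 * j + i) t = 0 :=
  Finset.sum_eq_zero fun k _ => by rw [quasiDeriv_two_mul_add, h, mul_zero, mul_zero]

theorem quasiDeriv_one_zero_right (x : ℝ) : quasiDeriv w ψ x 1 0 = 0 := by
  rw [quasiDeriv, flux_zero_right, mul_zero]

namespace IsSturmLiouvilleFamily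

theorem isQuasiDerivSeq_quasiDeriv (h : IsSturmLiouvilleFamily w ψ) (x : ℝ) :
    IsQuasiDerivSeq (quasiDeriv w ψ x) fun i t => if Even i then (w t)⁻¹ else w t where
  continuous i := by
    induction i using Nat.twoStepInduction with
    | zero => exact h.continuous x
    | one => exact (h.continuous_flux x).const_mul _
    | more i ih _ => exact ih.const_mul _
  hasDerivAt i t ht := by
    induction i using Nat.twoStepInduction with
    | zero =>
      refine (h.hasDerivAt x t ht.le).congr_deriv ?_
      simp only [Even.zero, if_true, quasiDeriv]
      ring
    | one =>
      refine ((h.hasDerivAt_flux x t).const_mul (-x ^ 2)).congr_deriv ?_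
      simp only [Nat.not_even_one, if_false, quasiDeriv]
      ring
    | more i ih _ =>
      refine (ih.const_mul (-x ^ 2)).congr_deriv ?_
      simp only [Nat.even_add, even_two, iff_true, quasiDeriv]
      ring
  ne_zero i t ht := by
    have hw := (h.weight_pos t ht).ne'
    split_ifs
    exacts [inv_ne_zero hw, hw]
  contDiffOn_factor i := by
    split_ifs
    exacts [h.contDiffOn_weight.inv fun t ht => (h.weight_pos t ht).ne', h.contDiffOn_weight]

theorem isQuasiDerivSeq_modeSum (h : IsSturmLiouvilleFamily w ψ) (x : ℕ → ℝ) (n : ℕ)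
    (a : ℕ → ℝ) :
    IsQuasiDerivSeq (modeSum w ψ x n a) fun i t => if Even i then (w t)⁻¹ else w t where
  continuous i := continuous_finsetSum _ fun k _ =>
    ((h.isQuasiDerivSeq_quasiDeriv (x k)).continuous i).const_mul _
  hasDerivAt i t ht := by
    refine (HasDerivAt.fun_sum fun k _ =>
      ((h.isQuasiDerivSeq_quasiDeriv (x k)).hasDerivAt i t ht).const_mul (a k)).congr_deriv ?_
    rw [modeSum, Finset.mul_sum]
    exact Finset.sum_congr rfl fun k _ => mul_left_comm _ _ _
  ne_zero := (h.isQuasiDerivSeq_quasiDeriv 0).ne_zero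
  contDiffOn_factor := (h.isQuasiDerivSeq_quasiDeriv 0).contDiffOn_factor

theorem continuous_uncurry_modeSum (h : IsSturmLiouvilleFamily w ψ) (x : ℕ → ℝ) (n i : ℕ) :
    Continuous (Function.uncurry fun a => modeSum w ψ x n a i) :=
  continuous_finsetSum (Finset.range n) fun k _ =>
    ((continuous_apply k).comp continuous_fst).mul
      (((h.isQuasiDerivSeq_quasiDeriv (x k)).continuous i).comp continuous_snd)

end IsSturmLiouvilleFamily

theorem IsZeroMultiset.exists_zero_uIcc {R c : ℕ → ℝ → ℝ} {s : Multiset ℝ}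
    (hs : IsZeroMultiset (fun j => R (i + j)) s) (hR : IsQuasiDerivSeq R c)
    (hpos : ∀ a ∈ s, 0 < a) {k l : s} (hkl : k ≠ l) :
    ∃ t ∈ uIcc (k : ℝ) l, R (i + 1) t = 0 := by
  wlog hle : (k : ℝ) ≤ l generalizing k l
  · rw [uIcc_comm]
    exact this hkl.symm (not_le.1 hle).le
  have hk : R i k = 0 := hs.eq_zero_of_mem Multiset.coe_mem
  have hl : R i l = 0 := hs.eq_zero_of_mem Multiset.coe_mem
  rcases hle.lt_or_eq with hlt | heq
  · obtain ⟨t, ht, ht0⟩ := hR.exists_zero_between (hpos k Multiset.coe_mem).le hlt hk hl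
    exact ⟨t, Icc_subset_uIcc (Ioo_subset_Icc_self ht), ht0⟩
  · refine ⟨k, left_mem_uIcc, hs k 1 ?_⟩
    obtain ⟨k, m⟩ := k
    obtain ⟨l, m'⟩ := l
    obtain rfl : k = l := heq
    have hm : (m : ℕ) ≠ m' := fun e => hkl (by rw [Fin.ext e])
    change 1 < s.count k
    omega

/- Passing from `i` to `2 j + i` multiplies the `k`-th coefficient by `(-x_k²)^j`; relative to the
last one, all other coefficients become negligible as `j → ∞`. -/
theorem modeSum_indicator_mul_div_pow (j i : ℕ) (t : ℝ) :
    modeSum w ψ x (q + 1) ((Iic q).indicator fun k => a k * ((x k / x q) ^ 2) ^ j) i t =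
      modeSum w ψ x (q + 1) a (2 * j + i) t / (-x q ^ 2) ^ j := by
  rw [modeSum, modeSum, Finset.sum_div]
  refine Finset.sum_congr rfl fun k hk => ?_
  rw [indicator_of_mem (mem_Iic.2 (Nat.lt_succ_iff.1 (Finset.mem_range.1 hk))),
    quasiDeriv_two_mul_add, div_pow, ← neg_div_neg_eq, div_pow]
  ring

theorem tendsto_indicator_mul_div_pow (hx : StrictMono x) (hx0 : 0 ≤ x 0) (hxq : 0 < x q)
    (a : ℕ → ℝ) :
    Tendsto (fun j : ℕ => (Iic q).indicator fun k => a k * ((x k / x q) ^ 2) ^ j) atTop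
      (𝓝 (Pi.single q (a q))) := by
  refine tendsto_pi_nhds.2 fun k => ?_
  rcases lt_trichotomy k q with hk | rfl | hk
  · simp only [indicator_of_mem (mem_Iic.2 hk.le), Pi.single_eq_of_ne hk.ne]
    have hxk : 0 ≤ x k := hx0.trans (hx.monotone k.zero_le)
    have hlt : (x k / x q) ^ 2 < 1 :=
      pow_lt_one₀ (by positivity) ((div_lt_one hxq).2 (hx hk)) two_ne_zero
    simpa using (tendsto_pow_atTop_nhds_zero_of_lt_one (sq_nonneg _) hlt).const_mul (a k)
  · simp [div_self hxq.ne']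
  · simp [hk.not_ge, hk.ne']

theorem modeSum_single (a₀ : ℝ) (i : ℕ) (t : ℝ) :
    modeSum w ψ x (q + 1) (Pi.single q a₀) i t = a₀ * quasiDeriv w ψ (x q) i t := by
  rw [modeSum, Finset.sum_range_succ, Finset.sum_eq_zero, zero_add, Pi.single_eq_same]
  intro k hk
  rw [Pi.single_eq_of_ne (Finset.mem_range.1 hk).ne, zero_mul]

namespace IsSturmLiouvilleFamily

theorem le_encard_psi_zeros_of_frequently (h : IsSturmLiouvilleFamily w ψ) (hx : StrictMono x)
    (hx0 : 0 ≤ x 0) (hxq : 0 < x q) (hq : a q ≠ 0)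
    (hzeros : ∃ᶠ j in atTop, ∃ s : Multiset ℝ, N ≤ s.card ∧ (∀ t ∈ s, t ∈ Ioc 0 τ) ∧
      IsZeroMultiset (fun i => modeSum w ψ x (q + 1) a (2 * j + i)) s) :
    (N : ℕ∞) ≤ {t ∈ Ioc 0 τ | ψ (x q) t = 0}.encard := by
  have hlim := tendsto_indicator_mul_div_pow hx hx0 hxq a
  have hF := h.continuous_uncurry_modeSum x (q + 1) 0
  have hnear : ∀ᶠ p : (ℕ → ℝ) × ℝ in 𝓝 (Pi.single q (a q)) ×ˢ 𝓝[>] 0,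
      modeSum w ψ x (q + 1) p.1 0 p.2 ≠ 0 := by
    refine Eventually.filter_mono (Filter.prod_mono le_rfl nhdsWithin_le_nhds) ?_
    rw [← nhds_prod_eq]
    refine hF.continuousAt.eventually_ne ?_
    simpa [Function.uncurry, modeSum_single, quasiDeriv, h.apply_zero] using hq
  have hlimit := eventually_card_le_encard_zeros hF (h.continuous_uncurry_modeSum x (q + 1) 1)
    hnear (τ := τ) fun t ht hFt hGt => by
      rw [modeSum_single] at hFt hGt
      have hψ : ψ (x q) t = 0 := (mul_eq_zero.1 hFt).resolve_left hq
      have hqd := (mul_eq_zero.1 hGt).resolve_left hq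
      exact h.flux_ne_zero ht.1 hψ ((mul_eq_zero.1 hqd).resolve_left (by simpa using hxq.ne'))
  obtain ⟨j, ⟨s, hN, hs, hzero⟩, hj⟩ := (hzeros.and_eventually (hlim.eventually hlimit)).exists
  have hle := hj s (fun k => k) (fun k => ⟨hs k Multiset.coe_mem, ?_⟩) fun k l hkl => ?_
  · have hset : {t ∈ Ioc 0 τ | modeSum w ψ x (q + 1) (Pi.single q (a q)) 0 t = 0} =
        {t ∈ Ioc 0 τ | ψ (x q) t = 0} := by
      simp [modeSum_single, quasiDeriv, hq]
    rw [hset, ENat.card_eq_coe_fintype_card, Multiset.card_coe] at hle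
    exact le_trans (by exact_mod_cast hN) hle
  · rw [modeSum_indicator_mul_div_pow, hzero.eq_zero_of_mem Multiset.coe_mem, zero_div]
  · obtain ⟨t, ht, ht0⟩ := hzero.exists_zero_uIcc (h.isQuasiDerivSeq_modeSum x (q + 1) a)
      (fun t ht => (hs t ht).1) hkl
    exact ⟨t, ht, by rw [modeSum_indicator_mul_div_pow, ht0, zero_div]⟩

end IsSturmLiouvilleFamily

end Modes

section Chebyshev

variable {w : ℝ → ℝ} {ψ : ℝ → ℝ → ℝ} {τ : ℝ} {x a : ℕ → ℝ} {q M N : ℕ}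

namespace IsSturmLiouvilleFamily

theorem lt_encard_psi_zeros_of_hasInteriorZeros (h : IsSturmLiouvilleFamily w ψ) (hτ : 0 < τ)
    (hx : StrictMono x) (hx0 : 0 ≤ x 0) (hxq : 0 < x q) (hq : a q ≠ 0)
    (hbdry : ∀ k, ψ (x k) τ = 0) (hzeros : HasInteriorZeros (modeSum w ψ x (q + 1) a) τ 0 N) :
    (N + 1 : ℕ) ≤ {y ∈ Ioc 0 (x q) | ψ y τ = 0}.encard := by
  have hR := h.isQuasiDerivSeq_modeSum x (q + 1) a
  have heven : ∀ j, modeSum w ψ x (q + 1) a (2 * j) τ = 0 := modeSum_eq_zero (i := 0) hbdry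
  have hodd : ∀ j, modeSum w ψ x (q + 1) a (2 * j + 1) 0 = 0 :=
    modeSum_eq_zero fun k => quasiDeriv_one_zero_right (x k)
  have hall : ∀ j, HasInteriorZeros (modeSum w ψ x (q + 1) a) τ (2 * j) N := fun j => by
    induction j with
    | zero => exact hzeros
    | succ j ih =>
      exact (ih.rolle hR hτ (E := {τ}) (by simp [heven]) le_rfl).rolle hR hτ (E := {0})
        (by simp [hodd]) le_rfl
  refine (h.le_encard_psi_zeros_of_frequently hx hx0 hxq hq (τ := τ)
    (Frequently.of_forall fun j => ?_)).trans (h.encard_psi_zeros_le hxq.le)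
  obtain ⟨s, hN, hs, hzero⟩ := hall j
  have hτs : τ ∉ s := fun hmem => (hs τ hmem).2.false
  refine ⟨τ ::ₘ s, by simpa using hN, ?_, fun t m hm => ?_⟩
  · simp only [Multiset.mem_cons, forall_eq_or_imp]
    exact ⟨⟨hτ, le_rfl⟩, fun t ht => Ioo_subset_Ioc_self (hs t ht)⟩
  · rw [Multiset.count_cons] at hm
    split_ifs at hm with htτ
    · subst htτ
      obtain rfl : m = 0 := by simpa [Multiset.count_eq_zero_of_notMem hτs] using hm
      exact heven j
    · exact hzero t m hm

theorem lt_encard_flux_zeros_of_hasInteriorZeros (h : IsSturmLiouvilleFamily w ψ) (hτ : 0 < τ)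
    (hx : StrictMono x) (hx0 : 0 ≤ x 0) (hxq : 0 < x q) (hq : a q ≠ 0)
    (hbdry : ∀ k, quasiDeriv w ψ (x k) 1 τ = 0)
    (hzeros : HasInteriorZeros (modeSum w ψ x (q + 1) a) τ 1 N) :
    (N + 1 : ℕ) ≤ {y ∈ Ioc 0 (x q) | flux w ψ y τ = 0}.encard := by
  have hR := h.isQuasiDerivSeq_modeSum x (q + 1) a
  have hodd : ∀ j, ∀ e ∈ ({0, τ} : Finset ℝ),
      (e = 0 ∨ e = τ) ∧ modeSum w ψ x (q + 1) a (2 * j + 1) e = 0 := fun j => by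
    simp [modeSum_eq_zero hbdry, modeSum_eq_zero fun k => quasiDeriv_one_zero_right (x k)]
  have hstep : ∀ j, HasInteriorZeros (modeSum w ψ x (q + 1) a) τ (2 * j + 1) N →
      HasInteriorZeros (modeSum w ψ x (q + 1) a) τ (2 * (j + 1)) (N + 1) := fun j hj =>
    hj.rolle hR hτ (hodd j) (by simp [Finset.card_pair hτ.ne])
  have hall : ∀ j, HasInteriorZeros (modeSum w ψ x (q + 1) a) τ (2 * j + 1) N := fun j => by
    induction j with
    | zero => exact hzeros
    | succ j ih => exact (hstep j ih).rolle hR hτ (E := ∅) (by simp) le_rfl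
  have hψ : (N + 1 : ℕ) ≤ {t ∈ Ioc 0 τ | ψ (x q) t = 0}.encard := by
    refine h.le_encard_psi_zeros_of_frequently hx hx0 hxq hq
      ((eventually_ge_atTop 1).mono fun j hj => ?_).frequently
    obtain ⟨s, hN, hs, hzero⟩ := hstep _ (hall (j - 1))
    rw [Nat.sub_add_cancel hj] at hzero
    exact ⟨s, hN, fun t ht => Ioo_subset_Ioc_self (hs t ht), hzero⟩
  have hinterior : (N : ℕ∞) ≤ {t ∈ Ioo 0 τ | flux w ψ (x q) t = 0}.encard := by
    have hle := hψ.trans (h.encard_psi_zeros_le_encard_flux_zeros_add_one (x q) τ)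
    push_cast at hle
    exact (ENat.add_le_add_iff_right ENat.one_ne_top).1 hle
  have hfluxτ : flux w ψ (x q) τ = 0 :=
    (mul_eq_zero.1 (hbdry q)).resolve_left (by simpa using hxq.ne')
  calc ((N + 1 : ℕ) : ℕ∞) ≤ {t ∈ Ioo 0 τ | flux w ψ (x q) t = 0}.encard + 1 := by
        push_cast
        gcongr
    _ = (insert τ {t ∈ Ioo 0 τ | flux w ψ (x q) t = 0}).encard :=
        (encard_insert_of_notMem (by simp)).symm
    _ ≤ {t ∈ Ioc 0 τ | flux w ψ (x q) t = 0}.encard :=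
        encard_le_encard (insert_subset ⟨⟨hτ, le_rfl⟩, hfluxτ⟩ fun t ht =>
          ⟨Ioo_subset_Ioc_self ht.1, ht.2⟩)
    _ ≤ {y ∈ Ioc 0 (x q) | flux w ψ y τ = 0}.encard := h.encard_flux_zeros_le hxq.le

end IsSturmLiouvilleFamily

theorem isChebyshevSystem_of_leading_coeff {f : ℕ → ℝ → ℝ} {I : Set ℝ}
    (h : ∀ (q : ℕ) (A : ℕ → ℝ), A q ≠ 0 →
      zeroCount I (fun t => ∑ k ∈ Finset.range (q + 1), A k * f k t) < ((q + 1 : ℕ) : ℕ∞)) :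
    IsChebyshevSystem f I := by
  intro n
  induction n with
  | zero => rintro A ⟨k, hk, -⟩; omega
  | succ n ih =>
    rintro A ⟨k, hk, hAk⟩
    by_cases hn : A n = 0
    · have hkn : k ≠ n := fun e => hAk (e ▸ hn)
      have hlt := ih A ⟨k, by omega, hAk⟩
      simp only [Finset.sum_range_succ, hn, zero_mul, add_zero]
      exact hlt.trans (by exact_mod_cast Nat.lt_succ_self n)
    · exact h n A hn

/-- The sequence `c, u 0, u 1, …`. -/
def seqCons (c : ℝ) (u : ℕ → ℝ) : ℕ → ℝ
  | 0 => c
  | k + 1 => u k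

theorem strictMono_seqCons_zero (hx : StrictMono x) (hpos : ∀ k, 0 < x k) :
    StrictMono (seqCons 0 x) :=
  strictMono_nat_of_lt_succ fun
    | 0 => hpos 0
    | k + 1 => hx k.lt_succ_self

theorem IsQuasiDerivSeq.isZeroMultiset {R c : ℕ → ℝ → ℝ} (hR : IsQuasiDerivSeq R c) {i : ℕ}
    {s : Multiset ℝ} (hs : ∀ t ∈ s, 0 < t)
    (h : IsZeroMultiset (fun j => iteratedDeriv j (R i)) s) :
    IsZeroMultiset (fun j => R (i + j)) s := fun t _ hm =>
  hR.eq_zero_of_iteratedDeriv (hs t (Multiset.count_pos.1 (pos_of_gt hm)))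
    (fun j hj => h t j hj) _ hm

theorem exists_isZeroMultiset_of_lt_zeroCount_Ioo {p : ℝ → ℝ}
    (h : (M : ℕ∞) < zeroCount (Ioo 0 τ) p) :
    ∃ s : Multiset ℝ, M + 1 ≤ s.card ∧ (∀ t ∈ s, t ∈ Ioo 0 τ) ∧
      IsZeroMultiset (fun j => iteratedDeriv j p) s := by
  obtain ⟨s, E, hs, hzero, hE, hM⟩ := exists_isZeroMultiset_of_lt_zeroCount h
  rw [interior_Ioo] at hs hE
  obtain rfl : E = ∅ := Finset.eq_empty_of_forall_notMem fun e he => (hE e he).1.2 (hE e he).1.1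
  exact ⟨s, hM, hs, hzero⟩

theorem hasInteriorZeros_zero_of_lt_zeroCount_Ioo {R c : ℕ → ℝ → ℝ} (hR : IsQuasiDerivSeq R c)
    (h : (M : ℕ∞) < zeroCount (Ioo 0 τ) (R 0)) : HasInteriorZeros R τ 0 (M + 1) := by
  obtain ⟨s, hM, hs, hzero⟩ := exists_isZeroMultiset_of_lt_zeroCount_Ioo h
  exact ⟨s, hM, hs, hR.isZeroMultiset (fun t ht => (hs t ht).1) hzero⟩

theorem hasInteriorZeros_one_of_lt_zeroCount_Icc {R c : ℕ → ℝ → ℝ} (hR : IsQuasiDerivSeq R c)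
    (hτ : 0 < τ) (h : (M : ℕ∞) < zeroCount (Icc 0 τ) (R 0)) : HasInteriorZeros R τ 1 M := by
  obtain ⟨s, E, hs, hzero, hE, hM⟩ := exists_isZeroMultiset_of_lt_zeroCount h
  rw [interior_Icc] at hs hE
  have hs0 : HasInteriorZeros R τ 0 s.card :=
    ⟨s, le_rfl, hs, hR.isZeroMultiset (fun t ht => (hs t ht).1) hzero⟩
  refine hs0.rolle hR hτ (fun e he => ⟨?_, (hE e he).2⟩) hM
  have hmem := (hE e he).1
  rw [Icc_sdiff_Ioo_same hτ.le] at hmem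
  exact hmem

theorem hasInteriorZeros_one_of_lt_zeroCount_deriv {R c : ℕ → ℝ → ℝ} (hR : IsQuasiDerivSeq R c)
    {p : ℝ → ℝ} (hp : ∀ t, 0 < t → p t = deriv (R 0) t)
    (h : (M : ℕ∞) < zeroCount (Ioo 0 τ) p) : HasInteriorZeros R τ 1 (M + 1) := by
  obtain ⟨s, hM, hs, hzero⟩ := exists_isZeroMultiset_of_lt_zeroCount_Ioo h
  refine ⟨s, hM, hs, hR.isZeroMultiset (fun t ht => (hs t ht).1) fun t m hm => ?_⟩
  have ht : 0 < t := (hs t (Multiset.count_pos.1 (pos_of_gt hm))).1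
  refine hR.iteratedDeriv_succ_eq_zero ht (fun j hj => ?_) m hm
  have hev : p =ᶠ[𝓝 t] deriv (R 0) := (lt_mem_nhds ht).mono hp
  rw [← hev.iteratedDeriv_eq]
  exact hzero t j hj

theorem exists_eq_zero_of_zeroCount_pos {I : Set ℝ} {p : ℝ → ℝ} (h : 0 < zeroCount I p) :
    ∃ t, p t = 0 := by
  obtain ⟨s, E, -, hzero, hE, hcard⟩ := exists_isZeroMultiset_of_lt_zeroCount (M := 0) (mod_cast h)
  obtain hs | hE0 := Nat.add_pos_iff_pos_or_pos.1 hcard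
  · obtain ⟨t, ht⟩ := Multiset.card_pos_iff_exists_mem.1 hs
    exact ⟨t, by simpa using hzero.eq_zero_of_mem ht⟩
  · obtain ⟨e, he⟩ := Finset.card_pos.1 hE0
    exact ⟨e, (hE e he).2⟩

namespace IsSturmLiouvilleFamily

theorem isChebyshevSystem_psi (h : IsSturmLiouvilleFamily w ψ) (hτ : 0 < τ) :
    IsChebyshevSystem (fun k => ψ (nthSmallest {y | 0 < y ∧ ψ y τ = 0} k)) (Ioo 0 τ) := by
  have hfin := h.finite_psi_zeros hτ
  have hinf := h.infinite_psi_zeros hτ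
  have hmem := nthSmallest_mem hfin hinf
  refine isChebyshevSystem_of_leading_coeff fun q A hq => ?_
  by_contra! hcount
  have hzeros : HasInteriorZeros
      (modeSum w ψ (nthSmallest {y | 0 < y ∧ ψ y τ = 0}) (q + 1) A) τ 0 (q + 1) :=
    hasInteriorZeros_zero_of_lt_zeroCount_Ioo (h.isQuasiDerivSeq_modeSum _ _ _)
      (lt_of_lt_of_le (by exact_mod_cast q.lt_succ_self) hcount)
  have hle := h.lt_encard_psi_zeros_of_hasInteriorZeros hτ (nthSmallest_strictMono hfin hinf)
    (hmem 0).1.le (hmem q).1 hq (fun k => (hmem k).2) hzeros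
  have hsub : {y ∈ Ioc 0 (nthSmallest {y | 0 < y ∧ ψ y τ = 0} q) | ψ y τ = 0} ⊆
      {y | 0 < y ∧ ψ y τ = 0} ∩ Iic (nthSmallest {y | 0 < y ∧ ψ y τ = 0} q) :=
    fun y hy => ⟨⟨hy.1.1, hy.2⟩, hy.1.2⟩
  have hlt : q + 1 + 1 ≤ q + 1 := by
    exact_mod_cast hle.trans ((encard_le_encard hsub).trans
      (encard_inter_Iic_nthSmallest_le hfin hinf q))
  omega

theorem modeSum_seqCons_zero (h : IsSturmLiouvilleFamily w ψ) (x : ℕ → ℝ) (n : ℕ) (a : ℕ → ℝ)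
    (t : ℝ) : modeSum w ψ (seqCons 0 x) (n + 1) a 0 t =
      a 0 + ∑ k ∈ Finset.range n, a (k + 1) * ψ (x k) t := by
  simp [modeSum, Finset.sum_range_succ', seqCons, quasiDeriv, h.apply_param_zero, add_comm]

theorem le_of_hasInteriorZeros_one (h : IsSturmLiouvilleFamily w ψ) (hτ : 0 < τ)
    (hq : a (q + 1) ≠ 0) (hzeros : HasInteriorZeros
      (modeSum w ψ (seqCons 0 (nthSmallest {y | 0 < y ∧ flux w ψ y τ = 0})) (q + 2) a) τ 1 N) :
    N ≤ q := by
  have hfin := h.finite_flux_zeros hτ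
  have hinf := h.infinite_flux_zeros hτ
  have hmem := nthSmallest_mem hfin hinf
  have hbdry : ∀ k, quasiDeriv w ψ
      (seqCons 0 (nthSmallest {y | 0 < y ∧ flux w ψ y τ = 0}) k) 1 τ = 0
    | 0 => by simp [quasiDeriv, seqCons]
    | k + 1 => mul_eq_zero_of_right _ (hmem k).2
  have hle := h.lt_encard_flux_zeros_of_hasInteriorZeros (q := q + 1) hτ
    (strictMono_seqCons_zero (nthSmallest_strictMono hfin hinf) fun k => (hmem k).1) le_rfl
    (hmem q).1 hq hbdry hzeros
  have hsub : {y ∈ Ioc 0 (nthSmallest {y | 0 < y ∧ flux w ψ y τ = 0} q) | flux w ψ y τ = 0} ⊆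
      {y | 0 < y ∧ flux w ψ y τ = 0} ∩ Iic (nthSmallest {y | 0 < y ∧ flux w ψ y τ = 0} q) :=
    fun y hy => ⟨⟨hy.1.1, hy.2⟩, hy.1.2⟩
  have hlt : N + 1 ≤ q + 1 := by
    exact_mod_cast hle.trans ((encard_le_encard hsub).trans
      (encard_inter_Iic_nthSmallest_le hfin hinf q))
  omega

theorem isChebyshevSystem_consOne (h : IsSturmLiouvilleFamily w ψ) (hτ : 0 < τ) :
    IsChebyshevSystem (consOne fun k => ψ (nthSmallest {y | 0 < y ∧ flux w ψ y τ = 0} k))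
      (Icc 0 τ) := by
  set x := nthSmallest {y | 0 < y ∧ flux w ψ y τ = 0}
  refine isChebyshevSystem_of_leading_coeff fun q A hq => ?_
  by_contra! hcount
  have hsum : (fun t => ∑ k ∈ Finset.range (q + 1), A k * consOne (fun k => ψ (x k)) k t) =
      modeSum w ψ (seqCons 0 x) (q + 1) A 0 := by
    funext t
    simp [h.modeSum_seqCons_zero, Finset.sum_range_succ', consOne, add_comm]
  rw [hsum] at hcount
  cases q with
  | zero =>
    obtain ⟨t, ht⟩ := exists_eq_zero_of_zeroCount_pos (one_pos.trans_le (by simpa using hcount))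
    exact hq (by simpa [h.modeSum_seqCons_zero] using ht)
  | succ q =>
    have hzeros : HasInteriorZeros (modeSum w ψ (seqCons 0 x) (q + 2) A) τ 1 (q + 1) :=
      hasInteriorZeros_one_of_lt_zeroCount_Icc (h.isQuasiDerivSeq_modeSum _ _ _) hτ
        (lt_of_lt_of_le (by exact_mod_cast (q + 1).lt_succ_self) hcount)
    have hle := h.le_of_hasInteriorZeros_one hτ hq hzeros
    omega

theorem isChebyshevSystem_deriv (h : IsSturmLiouvilleFamily w ψ) (hτ : 0 < τ) :
    IsChebyshevSystem (fun k => deriv (ψ (nthSmallest {y | 0 < y ∧ flux w ψ y τ = 0} k)))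
      (Ioo 0 τ) := by
  set x := nthSmallest {y | 0 < y ∧ flux w ψ y τ = 0}
  refine isChebyshevSystem_of_leading_coeff fun q A hq => ?_
  by_contra! hcount
  have hsum : ∀ t, 0 < t → ∑ k ∈ Finset.range (q + 1), A k * deriv (ψ (x k)) t =
      deriv (modeSum w ψ (seqCons 0 x) (q + 2) (seqCons 0 A) 0) t := fun t ht => by
    rw [funext (h.modeSum_seqCons_zero x (q + 1) (seqCons 0 A))]
    exact ((HasDerivAt.fun_sum fun k _ =>
      (h.hasDerivAt (x k) t ht.le).differentiableAt.hasDerivAt.const_mul _).const_add _).deriv.symm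
  have hzeros := hasInteriorZeros_one_of_lt_zeroCount_deriv (h.isQuasiDerivSeq_modeSum _ _ _)
    hsum (lt_of_lt_of_le (by exact_mod_cast q.lt_succ_self) hcount)
  have hle : q + 1 ≤ q := h.le_of_hasInteriorZeros_one (a := seqCons 0 A) hτ hq hzeros
  omega

theorem isChebyshevSystem_sub (h : IsSturmLiouvilleFamily w ψ) (hτ : 0 < τ) :
    IsChebyshevSystem (fun k t => ψ (nthSmallest {y | 0 < y ∧ flux w ψ y τ = 0} k) t -
      ψ (nthSmallest {y | 0 < y ∧ flux w ψ y τ = 0} k) τ) (Ioo 0 τ) := by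
  set x := nthSmallest {y | 0 < y ∧ flux w ψ y τ = 0}
  refine isChebyshevSystem_of_leading_coeff fun q A hq => ?_
  by_contra! hcount
  set a := seqCons (-∑ k ∈ Finset.range (q + 1), A k * ψ (x k) τ) A with ha
  have hsum : (fun t => ∑ k ∈ Finset.range (q + 1), A k * (ψ (x k) t - ψ (x k) τ)) =
      modeSum w ψ (seqCons 0 x) (q + 2) a 0 := by
    funext t
    simp only [h.modeSum_seqCons_zero, ha, seqCons, mul_sub, Finset.sum_sub_distrib]
    ring
  have hτ0 : modeSum w ψ (seqCons 0 x) (q + 2) a 0 τ = 0 := by simp [← hsum]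
  rw [hsum] at hcount
  have hR := h.isQuasiDerivSeq_modeSum (seqCons 0 x) (q + 2) a
  have hzeros : HasInteriorZeros (modeSum w ψ (seqCons 0 x) (q + 2) a) τ 0 (q + 1) :=
    hasInteriorZeros_zero_of_lt_zeroCount_Ioo hR
      (lt_of_lt_of_le (by exact_mod_cast q.lt_succ_self) hcount)
  have hle : q + 1 ≤ q := h.le_of_hasInteriorZeros_one hτ hq
    (hzeros.rolle hR hτ (E := {τ}) (by simpa using hτ0) (by simp))
  omega

end IsSturmLiouvilleFamily

end Chebyshev

section Primitive

theorem frequently_abs_le_of_hasDerivAt_zero {d D : ℝ → ℝ} (hdc : Continuous d)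
    (hd0 : HasDerivAt d 0 0) (hd : ∀ t, 0 < t → HasDerivAt d (D t) t) :
    ∃ᶠ t in 𝓝[>] 0, |D t| ≤ 1 := by
  refine (nhdsGT_basis (0 : ℝ)).frequently_iff.2 fun ε hε => ?_
  have hsmall : ∀ᶠ t in 𝓝 (0 : ℝ), ‖d t - d 0 - (t - 0) • (0 : ℝ)‖ ≤ 1 * ‖t - 0‖ :=
    hd0.isLittleO.def one_pos
  obtain ⟨t, ht, htε⟩ := ((hsmall.filter_mono nhdsWithin_le_nhds).and
    (Ioo_mem_nhdsGT hε)).exists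
  obtain ⟨ξ, hξ, hslope⟩ := exists_hasDerivAt_eq_slope d D htε.1 hdc.continuousOn
    fun s hs => hd s hs.1
  refine ⟨ξ, ⟨hξ.1, hξ.2.trans htε.2⟩, ?_⟩
  rw [hslope, sub_zero, abs_div, abs_of_pos htε.1, div_le_one htε.1]
  simpa [abs_of_pos htε.1] using ht

theorem mul_deriv_eq_neg_integral {w d D : ℝ → ℝ} {μ : ℝ} (hw : Continuous w) (hw0 : w 0 = 0)
    (hpos : ∀ t, 0 < t → 0 < w t) (hdc : Continuous d) (hd0 : HasDerivAt d 0 0)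
    (hd : ∀ t, 0 < t → HasDerivAt d (D t) t)
    (hode : ∀ t, 0 < t → HasDerivAt (fun s => w s * D s) (-(μ * w t * d t)) t) {t : ℝ}
    (ht : 0 < t) : w t * D t = -(μ * ∫ s in (0 : ℝ)..t, w s * d s) := by
  have hprim : ∀ s, HasDerivAt (fun s => ∫ r in (0 : ℝ)..s, w r * d r) (w s * d s) s := fun s =>
    ((hw.mul hdc).integral_hasStrictDerivAt 0 s).hasDerivAt
  set H : ℝ → ℝ := fun s => w s * D s + μ * ∫ r in (0 : ℝ)..s, w r * d r with hH
  have hHd : ∀ s, 0 < s → HasDerivAt H 0 s := fun s hs =>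
    ((hode s hs).add ((hprim s).const_mul μ)).congr_deriv (by ring)
  have hconst : ∀ s, 0 < s → H s = H t := fun s hs =>
    isOpen_Ioi.is_const_of_deriv_eq_zero isPreconnected_Ioi
      (fun x hx => (hHd x hx).differentiableAt.differentiableWithinAt)
      (fun x hx => (hHd x hx).deriv) hs ht
  have hle : ∃ᶠ s in 𝓝[>] 0, |H t - μ * ∫ r in (0 : ℝ)..s, w r * d r| ≤ w s := by
    refine ((frequently_abs_le_of_hasDerivAt_zero hdc hd0 hd).and_eventually
      self_mem_nhdsWithin).mono fun s hs => ?_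
    have hws := hpos s hs.2
    rw [← hconst s hs.2, hH, add_sub_cancel_right, abs_mul, abs_of_pos hws]
    exact mul_le_of_le_one_right hws.le hs.1
  have hleft : Tendsto (fun s => |H t - μ * ∫ r in (0 : ℝ)..s, w r * d r|) (𝓝[>] 0) (𝓝 |H t|) := by
    have hcont : ContinuousAt (fun s => |H t - μ * ∫ r in (0 : ℝ)..s, w r * d r|) 0 :=
      (((hprim 0).continuousAt.const_mul μ).const_sub _).abs
    simpa [ContinuousAt] using hcont.tendsto.mono_left nhdsWithin_le_nhds
  have hright : Tendsto w (𝓝[>] 0) (𝓝 0) := (hw.tendsto' 0 0 hw0).mono_left nhdsWithin_le_nhds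
  have hHt : H t = 0 :=
    abs_nonpos_iff.1 (le_of_tendsto_of_tendsto_of_frequently hleft hright hle)
  exact eq_neg_of_add_eq_zero_left hHt

theorem contDiffOn_primitive {f : ℝ → ℝ} (hf : Continuous f) {n : ℕ} {s : Set ℝ}
    (hs : IsOpen s) (hfs : ContDiffOn ℝ n f s) :
    ContDiffOn ℝ (n + 1) (fun t => ∫ r in (0 : ℝ)..t, f r) s := by
  have hd : ∀ t, HasDerivAt (fun t => ∫ r in (0 : ℝ)..t, f r) (f t) t := fun t =>
    (hf.integral_hasStrictDerivAt 0 t).hasDerivAt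
  rw [contDiffOn_succ_iff_deriv_of_isOpen hs]
  exact ⟨fun t _ => (hd t).differentiableAt.differentiableWithinAt, fun h => absurd h (by simp),
    hfs.congr fun t _ => (hd t).deriv⟩

end Primitive

end SturmLiouville

section Jacobi

open SturmLiouville

variable {α β lam T t : ℝ}

/-- The even extension `Δ(|t|)` of the weight. -/
noncomputable def jacobiEvenWeight (α β t : ℝ) : ℝ := jacobiWeight α β |t|

/-- The logarithmic derivative `Δ' / Δ` of the weight. -/
noncomputable def jacobiLogDeriv (α β t : ℝ) : ℝ :=
  (2 * α + 1) * (Real.cosh t / Real.sinh t) + (2 * β + 1) * (Real.sinh t / Real.cosh t)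

theorem jacobiEvenWeight_of_pos (ht : 0 < t) : jacobiEvenWeight α β t = jacobiWeight α β t := by
  rw [jacobiEvenWeight, abs_of_pos ht]

theorem jacobiEvenWeight_eventuallyEq (ht : 0 < t) :
    jacobiEvenWeight α β =ᶠ[𝓝 t] jacobiWeight α β :=
  (lt_mem_nhds ht).mono fun _ => jacobiEvenWeight_of_pos

theorem jacobiEvenWeight_zero (hα : -1 / 2 < α) : jacobiEvenWeight α β 0 = 0 := by
  have hexp : 2 * α + 1 ≠ 0 := by linarith
  simp [jacobiEvenWeight, jacobiWeight, Real.zero_rpow hexp]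

theorem jacobiEvenWeight_pos (ht : 0 < t) : 0 < jacobiEvenWeight α β t := by
  rw [jacobiEvenWeight_of_pos ht, jacobiWeight]
  have := Real.sinh_pos_iff.2 ht
  have := Real.cosh_pos t
  positivity

theorem jacobiEvenWeight_nonneg (α β t : ℝ) : 0 ≤ jacobiEvenWeight α β t := by
  have := Real.sinh_nonneg_iff.2 (abs_nonneg t)
  have := Real.cosh_pos |t|
  unfold jacobiEvenWeight jacobiWeight
  positivity

theorem continuous_jacobiEvenWeight (hβ : -1 / 2 ≤ β) (hα : -1 / 2 < α) :
    Continuous (jacobiEvenWeight α β) :=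
  (JacobiAux.weight_aux hβ hα).1

theorem contDiffOn_jacobiEvenWeight : ContDiffOn ℝ ∞ (jacobiEvenWeight α β) (Ioi 0) := by
  have hsinh : ContDiffOn ℝ ∞ (fun t => Real.sinh t ^ (2 * α + 1)) (Ioi 0) :=
    Real.contDiff_sinh.contDiffOn.rpow_const_of_ne fun t ht => (Real.sinh_pos_iff.2 ht).ne'
  have hcosh : ContDiffOn ℝ ∞ (fun t => Real.cosh t ^ (2 * β + 1)) (Ioi 0) :=
    Real.contDiff_cosh.contDiffOn.rpow_const_of_ne fun t _ => (Real.cosh_pos t).ne'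
  exact ((contDiffOn_const.mul hsinh).mul hcosh).congr fun _ => jacobiEvenWeight_of_pos

theorem hasDerivAt_jacobiEvenWeight (ht : 0 < t) :
    HasDerivAt (jacobiEvenWeight α β) (jacobiEvenWeight α β t * jacobiLogDeriv α β t) t := by
  have hsinh := Real.sinh_pos_iff.2 ht
  have hcosh := Real.cosh_pos t
  have hdsinh := (Real.hasDerivAt_sinh t).rpow_const (p := 2 * α + 1) (Or.inl hsinh.ne')
  have hdcosh := (Real.hasDerivAt_cosh t).rpow_const (p := 2 * β + 1) (Or.inl hcosh.ne')
  refine (((hdsinh.const_mul ((2 : ℝ) ^ (2 * jacobiRho α β))).mul hdcosh).congr_of_eventuallyEq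
    (jacobiEvenWeight_eventuallyEq ht)).congr_deriv ?_
  rw [Real.rpow_sub_one hsinh.ne', Real.rpow_sub_one hcosh.ne', jacobiEvenWeight_of_pos ht,
    jacobiWeight, jacobiLogDeriv]
  field_simp

theorem two_mul_jacobiRho_le_jacobiLogDeriv (hβ : -1 / 2 ≤ β) (hαβ : β ≤ α) (ht : 0 < t) :
    2 * jacobiRho α β ≤ jacobiLogDeriv α β t := by
  have hsinh := Real.sinh_pos_iff.2 ht
  have := Real.cosh_pos t
  have hlt := Real.sinh_lt_cosh t
  have hfactor : jacobiLogDeriv α β t - 2 * jacobiRho α β = (Real.cosh t - Real.sinh t) *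
      ((2 * α + 1) / Real.sinh t - (2 * β + 1) / Real.cosh t) := by
    unfold jacobiRho jacobiLogDeriv
    field_simp
    ring
  have hle : (2 * β + 1) / Real.cosh t ≤ (2 * α + 1) / Real.sinh t :=
    div_le_div₀ (by linarith) (by linarith) hsinh hlt.le
  rw [← sub_nonneg, hfactor]
  exact mul_nonneg (sub_nonneg.2 hlt.le) (sub_nonneg.2 hle)

theorem IsJacobiFunction.continuous {φ : ℝ → ℝ} (h : IsJacobiFunction α β lam φ) :
    Continuous φ := by
  refine continuous_of_even h.even fun t ht => ContinuousAt.continuousWithinAt ?_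
  rcases (mem_Ici.1 ht).eq_or_lt with rfl | ht
  · exact h.deriv_zero.continuousAt
  · exact (h.differentiable t ht).continuousAt

theorem continuous_jacobiPhi (hβ : -1 / 2 ≤ β) (hα : -1 / 2 < α) (lam : ℝ) :
    Continuous (jacobiPhi α β lam) :=
  (jacobiPhi_spec hβ hα lam).continuous

theorem jacobiPhi_neg (hβ : -1 / 2 ≤ β) (hα : -1 / 2 < α) (lam t : ℝ) :
    jacobiPhi α β lam (-t) = jacobiPhi α β lam t :=
  (jacobiPhi_spec hβ hα lam).even t

theorem jacobiPhi_zero_right (hβ : -1 / 2 ≤ β) (hα : -1 / 2 < α) (lam : ℝ) :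
    jacobiPhi α β lam 0 = 1 :=
  (jacobiPhi_spec hβ hα lam).map_zero

theorem hasDerivAt_jacobiPhi (hβ : -1 / 2 ≤ β) (hα : -1 / 2 < α) (lam : ℝ) (ht : 0 < t) :
    HasDerivAt (jacobiPhi α β lam) (deriv (jacobiPhi α β lam) t) t :=
  ((jacobiPhi_spec hβ hα lam).differentiable t ht).hasDerivAt

theorem hasDerivAt_flux_jacobiPhi (hβ : -1 / 2 ≤ β) (hα : -1 / 2 < α) (lam t : ℝ) :
    HasDerivAt (flux (jacobiEvenWeight α β) (jacobiPhi α β) lam)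
      (jacobiEvenWeight α β t * jacobiPhi α β lam t) t :=
  (((continuous_jacobiEvenWeight hβ hα).mul
    (continuous_jacobiPhi hβ hα lam)).integral_hasStrictDerivAt 0 t).hasDerivAt

theorem hasDerivAt_jacobiEvenWeight_mul_deriv_jacobiPhi (hβ : -1 / 2 ≤ β) (hα : -1 / 2 < α)
    (lam : ℝ) (ht : 0 < t) :
    HasDerivAt (fun s => jacobiEvenWeight α β s * deriv (jacobiPhi α β lam) s)
      (-((lam ^ 2 + jacobiRho α β ^ 2) * jacobiEvenWeight α β t * jacobiPhi α β lam t)) t := by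
  rw [jacobiEvenWeight_of_pos ht]
  exact ((jacobiPhi_spec hβ hα lam).ode t ht).congr_of_eventuallyEq
    ((jacobiEvenWeight_eventuallyEq ht).mul EventuallyEq.rfl)

theorem jacobiEvenWeight_mul_deriv_jacobiPhi (hβ : -1 / 2 ≤ β) (hα : -1 / 2 < α) (lam : ℝ)
    (ht : 0 < t) : jacobiEvenWeight α β t * deriv (jacobiPhi α β lam) t =
      -((lam ^ 2 + jacobiRho α β ^ 2) * flux (jacobiEvenWeight α β) (jacobiPhi α β) lam t) :=
  mul_deriv_eq_neg_integral (continuous_jacobiEvenWeight hβ hα) (jacobiEvenWeight_zero hα)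
    (fun _ => jacobiEvenWeight_pos) (continuous_jacobiPhi hβ hα lam)
    (jacobiPhi_spec hβ hα lam).deriv_zero (fun _ => hasDerivAt_jacobiPhi hβ hα lam)
    (fun _ => hasDerivAt_jacobiEvenWeight_mul_deriv_jacobiPhi hβ hα lam) ht

theorem contDiffOn_jacobiPhi (hβ : -1 / 2 ≤ β) (hα : -1 / 2 < α) (lam : ℝ) :
    ContDiffOn ℝ ∞ (jacobiPhi α β lam) (Ioi 0) := by
  have hw : ∀ n : ℕ, ContDiffOn ℝ n (jacobiEvenWeight α β) (Ioi 0) :=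
    contDiffOn_infty.1 contDiffOn_jacobiEvenWeight
  refine contDiffOn_infty.2 fun n => ?_
  induction n with
  | zero => exact contDiffOn_zero.2 (continuous_jacobiPhi hβ hα lam).continuousOn
  | succ n ih =>
    have hflux : ContDiffOn ℝ n (flux (jacobiEvenWeight α β) (jacobiPhi α β) lam) (Ioi 0) :=
      (contDiffOn_primitive ((continuous_jacobiEvenWeight hβ hα).mul
        (continuous_jacobiPhi hβ hα lam)) isOpen_Ioi ((hw n).mul ih)).of_le
          (by exact_mod_cast n.le_succ)
    have hderiv : EqOn (deriv (jacobiPhi α β lam)) (fun t => -(lam ^ 2 + jacobiRho α β ^ 2) *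
        (flux (jacobiEvenWeight α β) (jacobiPhi α β) lam t / jacobiEvenWeight α β t)) (Ioi 0) := by
      intro t ht
      have hflux_t := jacobiEvenWeight_mul_deriv_jacobiPhi hβ hα lam ht
      have hwt := (jacobiEvenWeight_pos (α := α) (β := β) ht).ne'
      field_simp
      linarith
    rw [Nat.cast_succ, contDiffOn_succ_iff_deriv_of_isOpen isOpen_Ioi]
    exact ⟨fun t ht => (hasDerivAt_jacobiPhi hβ hα lam ht).differentiableAt.differentiableWithinAt,
      fun h => absurd h (by simp), (contDiffOn_const.mul
        (hflux.div (hw n) fun t ht => (jacobiEvenWeight_pos ht).ne')).congr hderiv⟩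

section GroundState

/-- For `t > 0` this is `Δ exp(-2 ρ t) (φ_0 exp(ρ t))'`, so its sign decides the monotonicity of
`φ_0 exp(ρ t)`; written with the flux of `φ_0` in place of `φ_0'`, it is continuous at `0`. -/
noncomputable def jacobiSupersolutionDefect (α β t : ℝ) : ℝ :=
  Real.exp (-(jacobiRho α β * t)) *
    (jacobiRho α β * (jacobiEvenWeight α β t * jacobiPhi α β 0 t) -
      jacobiRho α β ^ 2 * flux (jacobiEvenWeight α β) (jacobiPhi α β) 0 t)

theorem hasDerivAt_exp_mul (c t : ℝ) :
    HasDerivAt (fun t => Real.exp (c * t)) (Real.exp (c * t) * c) t := by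
  simpa using ((hasDerivAt_id t).const_mul c).exp

theorem continuous_jacobiSupersolutionDefect (hβ : -1 / 2 ≤ β) (hα : -1 / 2 < α) :
    Continuous (jacobiSupersolutionDefect α β) := by
  have hw := continuous_jacobiEvenWeight hβ hα
  have hφ := continuous_jacobiPhi hβ hα 0
  have hflux : Continuous (flux (jacobiEvenWeight α β) (jacobiPhi α β) 0) :=
    continuous_iff_continuousAt.2 fun t => (hasDerivAt_flux_jacobiPhi hβ hα 0 t).continuousAt
  unfold jacobiSupersolutionDefect
  fun_prop

theorem jacobiSupersolutionDefect_zero (hα : -1 / 2 < α) :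
    jacobiSupersolutionDefect α β 0 = 0 := by
  simp [jacobiSupersolutionDefect, jacobiEvenWeight_zero hα, flux_zero_right]

theorem hasDerivAt_jacobiSupersolutionDefect (hβ : -1 / 2 ≤ β) (hα : -1 / 2 < α) (ht : 0 < t) :
    HasDerivAt (jacobiSupersolutionDefect α β) (Real.exp (-(jacobiRho α β * t)) *
      (jacobiRho α β * (jacobiEvenWeight α β t * jacobiPhi α β 0 t) *
        (jacobiLogDeriv α β t - 2 * jacobiRho α β))) t := by
  have hexp : HasDerivAt (fun t => Real.exp (-(jacobiRho α β * t)))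
      (Real.exp (-(jacobiRho α β * t)) * -jacobiRho α β) t := by
    simpa only [neg_mul] using hasDerivAt_exp_mul (-jacobiRho α β) t
  have hwφ :=
    (hasDerivAt_jacobiEvenWeight (α := α) (β := β) ht).mul (hasDerivAt_jacobiPhi hβ hα 0 ht)
  have hflux := hasDerivAt_flux_jacobiPhi hβ hα 0 t
  refine (hexp.mul ((hwφ.const_mul (jacobiRho α β)).sub
    (hflux.const_mul (jacobiRho α β ^ 2)))).congr_deriv ?_
  simp only [Pi.mul_apply, Pi.sub_apply]
  linear_combination Real.exp (-(jacobiRho α β * t)) * jacobiRho α β *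
    jacobiEvenWeight_mul_deriv_jacobiPhi hβ hα 0 ht

theorem jacobiSupersolutionDefect_nonneg (hβ : -1 / 2 ≤ β) (hαβ : β ≤ α) (hα : -1 / 2 < α)
    (hT : ∀ t ∈ Ioo 0 T, 0 ≤ jacobiPhi α β 0 t) (ht : t ∈ Icc 0 T) :
    0 ≤ jacobiSupersolutionDefect α β t := by
  have hρ : 0 ≤ jacobiRho α β := by unfold jacobiRho; linarith
  have hmono : MonotoneOn (jacobiSupersolutionDefect α β) (Icc 0 T) := by
    refine monotoneOn_of_deriv_nonneg (convex_Icc _ _)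
      (continuous_jacobiSupersolutionDefect hβ hα).continuousOn ?_ ?_ <;> rw [interior_Icc]
    · exact fun t ht =>
        (hasDerivAt_jacobiSupersolutionDefect hβ hα ht.1).differentiableAt.differentiableWithinAt
    · intro t ht
      rw [(hasDerivAt_jacobiSupersolutionDefect hβ hα ht.1).deriv]
      have hφ := hT t ht
      have hw := jacobiEvenWeight_nonneg α β t
      have hlog := sub_nonneg.2 (two_mul_jacobiRho_le_jacobiLogDeriv hβ hαβ ht.1)
      positivity
  rw [← jacobiSupersolutionDefect_zero (β := β) hα]
  exact hmono ⟨le_rfl, ht.1.trans ht.2⟩ ht ht.1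

theorem hasDerivAt_jacobiPhi_mul_exp (hβ : -1 / 2 ≤ β) (hα : -1 / 2 < α) (ht : 0 < t) :
    HasDerivAt (fun t => jacobiPhi α β 0 t * Real.exp (jacobiRho α β * t))
      (Real.exp (jacobiRho α β * t) ^ 2 * jacobiSupersolutionDefect α β t /
        jacobiEvenWeight α β t) t := by
  refine ((hasDerivAt_jacobiPhi hβ hα 0 ht).mul
    (hasDerivAt_exp_mul (jacobiRho α β) t)).congr_deriv ?_
  have hw := (jacobiEvenWeight_pos (α := α) (β := β) ht).ne'
  have hflux := jacobiEvenWeight_mul_deriv_jacobiPhi hβ hα 0 ht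
  rw [jacobiSupersolutionDefect, Real.exp_neg]
  field_simp
  linear_combination hflux

theorem monotoneOn_jacobiPhi_mul_exp_of_nonneg (hβ : -1 / 2 ≤ β) (hαβ : β ≤ α) (hα : -1 / 2 < α)
    (hT : ∀ t ∈ Ioo 0 T, 0 ≤ jacobiPhi α β 0 t) :
    MonotoneOn (fun t => jacobiPhi α β 0 t * Real.exp (jacobiRho α β * t)) (Icc 0 T) := by
  have hφ := continuous_jacobiPhi hβ hα 0
  refine monotoneOn_of_deriv_nonneg (convex_Icc _ _) (by fun_prop) ?_ ?_ <;> rw [interior_Icc]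
  · exact fun t ht =>
      (hasDerivAt_jacobiPhi_mul_exp hβ hα ht.1).differentiableAt.differentiableWithinAt
  · intro t ht
    rw [(hasDerivAt_jacobiPhi_mul_exp hβ hα ht.1).deriv]
    have hdefect := jacobiSupersolutionDefect_nonneg hβ hαβ hα hT (Ioo_subset_Icc_self ht)
    have hw := jacobiEvenWeight_nonneg α β t
    positivity

theorem jacobiPhi_zero_pos (hβ : -1 / 2 ≤ β) (hαβ : β ≤ α) (hα : -1 / 2 < α) (t : ℝ) :
    0 < jacobiPhi α β 0 t := by
  wlog ht : 0 ≤ t generalizing t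
  · rw [← jacobiPhi_neg hβ hα]
    exact this (-t) (by linarith)
  by_contra! hneg
  have hcompact : IsCompact (Icc 0 t ∩ {s | jacobiPhi α β 0 s ≤ 0}) :=
    isCompact_Icc.inter_right (isClosed_le (continuous_jacobiPhi hβ hα 0) continuous_const)
  obtain ⟨T, ⟨⟨hT0, hTt⟩, hT⟩, hmin⟩ := hcompact.exists_isLeast ⟨t, ⟨ht, le_rfl⟩, hneg⟩
  have hnonneg : ∀ s ∈ Ioo 0 T, 0 ≤ jacobiPhi α β 0 s := fun s hs => by
    by_contra! hs'
    exact (hmin ⟨⟨hs.1.le, hs.2.le.trans hTt⟩, hs'.le⟩).not_gt hs.2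
  have hmono := monotoneOn_jacobiPhi_mul_exp_of_nonneg hβ hαβ hα hnonneg
    ⟨le_rfl, hT0⟩ ⟨hT0, le_rfl⟩ hT0
  simp only [jacobiPhi_zero_right hβ hα, mul_zero, Real.exp_zero, mul_one] at hmono
  have hle := mul_nonpos_of_nonpos_of_nonneg hT (Real.exp_pos (jacobiRho α β * T)).le
  linarith

theorem monotoneOn_jacobiPhi_mul_exp (hβ : -1 / 2 ≤ β) (hαβ : β ≤ α) (hα : -1 / 2 < α) :
    MonotoneOn (fun t => jacobiPhi α β 0 t * Real.exp (jacobiRho α β * t)) (Ici 0) :=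
  fun _ hs t ht hst => monotoneOn_jacobiPhi_mul_exp_of_nonneg hβ hαβ hα (T := t)
    (fun s _ => (jacobiPhi_zero_pos hβ hαβ hα s).le) ⟨hs, hst⟩ ⟨ht, le_rfl⟩ hst

theorem monotoneOn_jacobiEvenWeight_mul_exp (hβ : -1 / 2 ≤ β) (hαβ : β ≤ α) (hα : -1 / 2 < α) :
    MonotoneOn (fun t => jacobiEvenWeight α β t * Real.exp (-(2 * jacobiRho α β) * t)) (Ici 0) := by
  have hd : ∀ t, 0 < t → HasDerivAt
      (fun t => jacobiEvenWeight α β t * Real.exp (-(2 * jacobiRho α β) * t))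
      (jacobiEvenWeight α β t * Real.exp (-(2 * jacobiRho α β) * t) *
        (jacobiLogDeriv α β t - 2 * jacobiRho α β)) t := fun t ht =>
    ((hasDerivAt_jacobiEvenWeight ht).mul
      (hasDerivAt_exp_mul (-(2 * jacobiRho α β)) t)).congr_deriv (by ring)
  have hw := continuous_jacobiEvenWeight hβ hα
  refine monotoneOn_of_deriv_nonneg (convex_Ici _) (by fun_prop) ?_ ?_ <;> rw [interior_Ici]
  · exact fun t ht => (hd t ht).differentiableAt.differentiableWithinAt
  · intro t ht
    rw [(hd t ht).deriv]
    have hwt := jacobiEvenWeight_nonneg α β t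
    have hlog := sub_nonneg.2 (two_mul_jacobiRho_le_jacobiLogDeriv hβ hαβ ht)
    positivity

end GroundState

section GroundStateTransform

/-- The weight `Δ φ_0²` of the equation satisfied by `ψ_lam = φ_lam / φ_0`, extended evenly. -/
noncomputable def jacobiGroundWeight (α β t : ℝ) : ℝ :=
  jacobiEvenWeight α β t * jacobiPhi α β 0 t ^ 2

theorem jacobiGroundWeight_pos (hβ : -1 / 2 ≤ β) (hαβ : β ≤ α) (hα : -1 / 2 < α) (ht : 0 < t) :
    0 < jacobiGroundWeight α β t :=
  mul_pos (jacobiEvenWeight_pos ht) (pow_pos (jacobiPhi_zero_pos hβ hαβ hα t) 2)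

theorem continuous_jacobiGroundWeight (hβ : -1 / 2 ≤ β) (hα : -1 / 2 < α) :
    Continuous (jacobiGroundWeight α β) :=
  (continuous_jacobiEvenWeight hβ hα).mul ((continuous_jacobiPhi hβ hα 0).pow 2)

theorem contDiffOn_jacobiGroundWeight (hβ : -1 / 2 ≤ β) (hα : -1 / 2 < α) :
    ContDiffOn ℝ ∞ (jacobiGroundWeight α β) (Ioi 0) :=
  contDiffOn_jacobiEvenWeight.mul ((contDiffOn_jacobiPhi hβ hα 0).pow 2)

theorem monotoneOn_jacobiGroundWeight (hβ : -1 / 2 ≤ β) (hαβ : β ≤ α) (hα : -1 / 2 < α) :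
    MonotoneOn (jacobiGroundWeight α β) (Ici 0) := by
  have hsplit : jacobiGroundWeight α β = fun t =>
      jacobiEvenWeight α β t * Real.exp (-(2 * jacobiRho α β) * t) *
        (jacobiPhi α β 0 t * Real.exp (jacobiRho α β * t)) ^ 2 := by
    funext t
    have hexp : Real.exp (-(2 * jacobiRho α β) * t) * Real.exp (jacobiRho α β * t) ^ 2 = 1 := by
      rw [← Real.exp_nat_mul, ← Real.exp_add, Real.exp_eq_one_iff]
      push_cast
      ring
    rw [mul_pow, mul_mul_mul_comm, hexp, mul_one, jacobiGroundWeight]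
  have hnonneg : ∀ t, 0 ≤ jacobiPhi α β 0 t * Real.exp (jacobiRho α β * t) := fun t =>
    (mul_pos (jacobiPhi_zero_pos hβ hαβ hα t) (Real.exp_pos _)).le
  rw [hsplit]
  exact (monotoneOn_jacobiEvenWeight_mul_exp hβ hαβ hα).mul
    (fun s hs t ht hst => pow_le_pow_left₀ (hnonneg s)
      (monotoneOn_jacobiPhi_mul_exp hβ hαβ hα hs ht hst) 2)
    (fun t _ => mul_nonneg (jacobiEvenWeight_nonneg α β t) (Real.exp_pos _).le)
    fun t _ => sq_nonneg _

theorem continuous_jacobiPsi (hβ : -1 / 2 ≤ β) (hαβ : β ≤ α) (hα : -1 / 2 < α) (lam : ℝ) :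
    Continuous (jacobiPsi α β lam) :=
  (continuous_jacobiPhi hβ hα lam).div (continuous_jacobiPhi hβ hα 0)
    fun t => (jacobiPhi_zero_pos hβ hαβ hα t).ne'

theorem hasDerivAt_jacobiPsi_zero (hβ : -1 / 2 ≤ β) (hαβ : β ≤ α) (hα : -1 / 2 < α) (lam : ℝ) :
    HasDerivAt (jacobiPsi α β lam) 0 0 :=
  ((jacobiPhi_spec hβ hα lam).deriv_zero.div (jacobiPhi_spec hβ hα 0).deriv_zero
    (jacobiPhi_zero_pos hβ hαβ hα 0).ne').congr_deriv (by simp)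

theorem hasDerivAt_jacobiPsi (hβ : -1 / 2 ≤ β) (hαβ : β ≤ α) (hα : -1 / 2 < α) (lam : ℝ)
    (ht : 0 < t) : HasDerivAt (jacobiPsi α β lam)
      ((deriv (jacobiPhi α β lam) t * jacobiPhi α β 0 t -
        jacobiPhi α β lam t * deriv (jacobiPhi α β 0) t) / jacobiPhi α β 0 t ^ 2) t :=
  (hasDerivAt_jacobiPhi hβ hα lam ht).div (hasDerivAt_jacobiPhi hβ hα 0 ht)
    (jacobiPhi_zero_pos hβ hαβ hα t).ne'

theorem hasDerivAt_jacobiGroundWeight_mul_deriv_jacobiPsi (hβ : -1 / 2 ≤ β) (hαβ : β ≤ α)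
    (hα : -1 / 2 < α) (lam : ℝ) (ht : 0 < t) :
    HasDerivAt (fun s => jacobiGroundWeight α β s * deriv (jacobiPsi α β lam) s)
      (-(lam ^ 2 * jacobiGroundWeight α β t * jacobiPsi α β lam t)) t := by
  have hwronskian : (fun s => jacobiGroundWeight α β s * deriv (jacobiPsi α β lam) s) =ᶠ[𝓝 t]
      fun s => jacobiPhi α β 0 s * (jacobiEvenWeight α β s * deriv (jacobiPhi α β lam) s) -
        jacobiPhi α β lam s * (jacobiEvenWeight α β s * deriv (jacobiPhi α β 0) s) := by
    filter_upwards [lt_mem_nhds ht] with s hs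
    have hφ := (jacobiPhi_zero_pos hβ hαβ hα s).ne'
    rw [(hasDerivAt_jacobiPsi hβ hαβ hα lam hs).deriv, jacobiGroundWeight]
    field_simp
  refine ((((hasDerivAt_jacobiPhi hβ hα 0 ht).mul
    (hasDerivAt_jacobiEvenWeight_mul_deriv_jacobiPhi hβ hα lam ht)).sub
    ((hasDerivAt_jacobiPhi hβ hα lam ht).mul
    (hasDerivAt_jacobiEvenWeight_mul_deriv_jacobiPhi hβ hα 0 ht))).congr_of_eventuallyEq
      hwronskian).congr_deriv ?_
  have := (jacobiPhi_zero_pos hβ hαβ hα t).ne'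
  rw [jacobiGroundWeight, jacobiPsi]
  field_simp
  ring

theorem isSturmLiouvilleFamily_jacobiPsi (hβ : -1 / 2 ≤ β) (hαβ : β ≤ α) (hα : -1 / 2 < α) :
    IsSturmLiouvilleFamily (jacobiGroundWeight α β) (jacobiPsi α β) where
  continuous_weight := continuous_jacobiGroundWeight hβ hα
  weight_pos _ := jacobiGroundWeight_pos hβ hαβ hα
  monotoneOn_weight := monotoneOn_jacobiGroundWeight hβ hαβ hα
  contDiffOn_weight := contDiffOn_jacobiGroundWeight hβ hα
  even lam t := by rw [jacobiPsi, jacobiPhi_neg hβ hα, jacobiPhi_neg hβ hα, jacobiPsi]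
  apply_zero lam := by
    rw [jacobiPsi, jacobiPhi_zero_right hβ hα, jacobiPhi_zero_right hβ hα, div_one]
  hasDerivAt lam t ht := by
    rcases ht.eq_or_lt with rfl | ht
    · simpa [flux_zero_right] using hasDerivAt_jacobiPsi_zero hβ hαβ hα lam
    have hd : ∀ t, 0 < t → HasDerivAt (jacobiPsi α β lam) (deriv (jacobiPsi α β lam) t) t :=
      fun t ht => (hasDerivAt_jacobiPsi hβ hαβ hα lam ht).differentiableAt.hasDerivAt
    refine (hd t ht).congr_deriv ?_
    rw [← mul_div_assoc, ← neg_div, eq_div_iff (jacobiGroundWeight_pos hβ hαβ hα ht).ne', mul_comm]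
    exact mul_deriv_eq_neg_integral (continuous_jacobiGroundWeight hβ hα)
      (by rw [jacobiGroundWeight, jacobiEvenWeight_zero hα, zero_mul])
      (fun _ => jacobiGroundWeight_pos hβ hαβ hα) (continuous_jacobiPsi hβ hαβ hα lam)
      (hasDerivAt_jacobiPsi_zero hβ hαβ hα lam) hd
      (fun _ => hasDerivAt_jacobiGroundWeight_mul_deriv_jacobiPsi hβ hαβ hα lam) ht

theorem jacobiZero_eq_nthSmallest (hβ : -1 / 2 ≤ β) (hαβ : β ≤ α) (hα : -1 / 2 < α) (τ : ℝ) :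
    jacobiZero α β τ = nthSmallest {lam | 0 < lam ∧ jacobiPsi α β lam τ = 0} := by
  funext k
  simp [jacobiZero, jacobiPsi, (jacobiPhi_zero_pos hβ hαβ hα τ).ne']

theorem jacobiZeroStar_eq_nthSmallest (hβ : -1 / 2 ≤ β) (hαβ : β ≤ α) (hα : -1 / 2 < α) {τ : ℝ}
    (hτ : 0 < τ) : jacobiZeroStar α β τ = nthSmallest
      {lam | 0 < lam ∧ flux (jacobiGroundWeight α β) (jacobiPsi α β) lam τ = 0} := by
  funext k
  unfold jacobiZeroStar
  congr! 3 with lam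
  refine and_congr_right fun hlam => ?_
  have hw := (jacobiGroundWeight_pos hβ hαβ hα hτ).ne'
  rw [((isSturmLiouvilleFamily_jacobiPsi hβ hαβ hα).hasDerivAt lam τ hτ.le).deriv]
  simp [hw, hlam.ne']

end GroundStateTransform

end Jacobi

theorem theorem5 (α β τ : ℝ) (hβ : -1 / 2 ≤ β) (hαβ : β ≤ α) (hα : -1 / 2 < α) (hτ : 0 < τ) :
    (IsChebyshevSystem (fun k t => jacobiPsi α β (jacobiZero α β τ k) t) (Set.Ioo 0 τ) ∧
      IsChebyshevSystem (consOne (fun k t => jacobiPsi α β (jacobiZeroStar α β τ k) t))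
        (Set.Icc 0 τ)) ∧
    (IsChebyshevSystem (fun k t => deriv (jacobiPsi α β (jacobiZeroStar α β τ k)) t)
        (Set.Ioo 0 τ) ∧
      IsChebyshevSystem (fun k t => jacobiPsi α β (jacobiZeroStar α β τ k) t -
        jacobiPsi α β (jacobiZeroStar α β τ k) τ) (Set.Ioo 0 τ)) := by
  have h := isSturmLiouvilleFamily_jacobiPsi hβ hαβ hα
  rw [jacobiZero_eq_nthSmallest hβ hαβ hα, jacobiZeroStar_eq_nthSmallest hβ hαβ hα hτ]
  exact ⟨⟨h.isChebyshevSystem_psi hτ, h.isChebyshevSystem_consOne hτ⟩,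
    h.isChebyshevSystem_deriv hτ, h.isChebyshevSystem_sub hτ⟩
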